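/- Let $\mathcal M$ be a smooth (finite-dimensional) Riemannian manifold without boundary, let $q\in\mathcal M$, and let $r_{\mathcal M}(q)\in(0,\infty]$ be the injectivity radius at $q$, i.e. the supremum of all $a$ such that the Riemannian exponential map $\operatorname{Exp}_q$ is defined on the open ball of radius $a$ around $0$ in $T_q\mathcal M$ and is a diffeomorphism from this ball onto an open subset of $\mathcal M$. Then there are a function $\eta:\mathbb R\to\mathbb R$ with $\eta(\delta)=o(\delta^2)$ as $\delta\to 0^+$ and a constant $C\in\mathbb R$, both depending only on $\mathcal M$ and $q$, such that the following holds. Let $\Delta,\tilde\Delta\in T_q\mathcal M$ be linearly independent tangent vectors with norms $\delta=\|\Delta\|<1$ and $\tilde\delta=\|\tilde\Delta\|<1$ and with $\delta,\tilde\delta<r_{\mathcal M}(q)$; let $s_0=\angle(\Delta,\tilde\Delta)$ be the angle between them, let $\sigma=\operatorname{span}(\Delta,\tilde\Delta)$ be the $2$-plane they span, and let $K_q(\sigma)$ be the sectional curvature of $\mathcal M$ at $q$ with respect to $\sigma$. Then the Riemannian distance between $p=\operatorname{Exp}_q(\Delta)$ and $\tilde p=\operatorname{Exp}_q(\tilde\Delta)$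 is finite and satisfies \[ \operatorname{dist}_{\mathcal M}(p,\tilde p)\;\le\; |\delta-\tilde\delta| + s_0\,\delta\Bigl(1-\frac{K_q(\sigma)}{6}\,\delta^2+\eta(\delta)\Bigr)+C\,s_0^2 . \] -/

import Mathlib

noncomputable section

namespace RiemannianGeometry

section Coordinates

variable {E : Type*} [NormedAddCommGroup E] [NormedSpace ℝ E]

/-- The Christoffel symbols of the first kind of a metric `g` given in coordinates, as the linear
form `w ↦ (∂_u g(v, w) + ∂_v g(u, w) - ∂_w g(u, v)) / 2` at the point `y`. -/
def christoffelForm (g : E → E →L[ℝ] E →L[ℝ] ℝ) (y u v : E) : E →L[ℝ] ℝ :=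
  let D : E →L[ℝ] E →L[ℝ] E →L[ℝ] ℝ := fderiv ℝ g y
  (1 / 2 : ℝ) • (D u v + D v u - (D.flip u).flip v)

/-- The Christoffel symbols of the Levi-Civita connection of a metric `g` given in coordinates:
`Γ_y(u, v)` is the vector such that
`g_y(Γ_y(u, v), w) = (∂_u g(v, w) + ∂_v g(u, w) - ∂_w g(u, v)) / 2` for all `w`. -/
def christoffel (g : E → E →L[ℝ] E →L[ℝ] ℝ) (y u v : E) : E :=
  (g y).inverse (christoffelForm g y u v)

/-- The Riemann curvature tensor of a metric `g` given in coordinates, with the sign convention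
`R(u, v)w = ∇_u ∇_v w - ∇_v ∇_u w - ∇_[u, v] w`, computed on constant vector fields. -/
def curvature (g : E → E →L[ℝ] E →L[ℝ] ℝ) (y u v w : E) : E :=
  fderiv ℝ (fun z ↦ christoffel g z v w) y u - fderiv ℝ (fun z ↦ christoffel g z u w) y v
    + christoffel g y u (christoffel g y v w) - christoffel g y v (christoffel g y u w)

/-- The sectional curvature at `y` of the plane spanned by the linearly independent vectors `u, v`,
for a metric `g` given in coordinates: `⟨R(u, v)v, u⟩ / (|u|² |v|² - ⟨u, v⟩²)`. -/
def coordSectionalCurvature (g : E → E →L[ℝ] E →L[ℝ] ℝ) (y u v : E) : ℝ :=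
  g y (curvature g y u v v) u / (g y u u * g y v v - g y u v ^ 2)

end Coordinates

end RiemannianGeometry

end

open Bundle Manifold Set
open scoped ContDiff Topology ENNReal NNReal

noncomputable section

namespace RiemannianGeometry

variable {E : Type*} [NormedAddCommGroup E] [NormedSpace ℝ E]
  {H : Type*} [TopologicalSpace H] (I : ModelWithCorners ℝ E H)
  {M : Type*} [TopologicalSpace M] [ChartedSpace H M]

variable [IsManifold I 1 M]

/-- The coordinates of a tangent vector `v` at `x` in the preferred chart `φ` at `x`: the
trivialization of the tangent bundle induced by `φ`, that is `dφ_x v`. -/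
def coordVector (x : M) (v : TangentSpace I x) : E :=
  (trivializationAt E (TangentSpace I : M → Type _) x).continuousLinearMapAt ℝ x v

variable [RiemannianBundle (fun x : M ↦ TangentSpace I x)]

/-- The metric tensor in the preferred chart `φ` at `x₀`, at the point `x = φ⁻¹ y` with coordinates
`y`: the inner product at `x` of the tangent vectors with coordinates `u` and `v` in `φ`. -/
def chartMetric (x₀ : M) (y : E) : E →L[ℝ] E →L[ℝ] ℝ :=
  let x : M := (extChartAt I x₀).symm y
  let A : E →L[ℝ] TangentSpace I x :=
    (trivializationAt E (TangentSpace I : M → Type _) x₀).symmL ℝ x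
  (ContinuousLinearMap.precomp ℝ A) ∘L
    (RiemannianBundle.g (E := fun x : M ↦ TangentSpace I x)).inner x ∘L A

theorem chartMetric_apply (x₀ : M) (y u v : E) :
    chartMetric I x₀ y u v =
      inner ℝ
        ((trivializationAt E (TangentSpace I : M → Type _) x₀).symmL ℝ
          ((extChartAt I x₀).symm y) u)
        ((trivializationAt E (TangentSpace I : M → Type _) x₀).symmL ℝ
          ((extChartAt I x₀).symm y) v) :=
  rfl

/-- The sectional curvature at `q` of the plane spanned by the linearly independent tangent
vectors `Δ₁, Δ₂`, computed in the preferred chart at `q`. -/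
def sectionalCurvature (q : M) (Δ₁ Δ₂ : TangentSpace I q) : ℝ :=
  coordSectionalCurvature (chartMetric I q) (extChartAt I q q)
    (coordVector I q Δ₁) (coordVector I q Δ₂)

/-- `c` is smooth around every time of `[0, 1]` and satisfies there the geodesic equation
`c'' + Γ(c', c') = 0`, in every preferred chart around the point. -/
def IsGeodesic (c : ℝ → M) : Prop :=
  ∀ t ∈ Icc (0 : ℝ) 1, ContMDiffAt 𝓘(ℝ, ℝ) I ∞ c t ∧
    ∀ x₀ : M, c t ∈ (extChartAt I x₀).source →
      let u : ℝ → E := fun s ↦ extChartAt I x₀ (c s)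
      deriv (deriv u) t + christoffel (chartMetric I x₀) (u t) (deriv u t) (deriv u t) = 0

/-- `c` is a geodesic on `[0, 1]` that starts at `q` with velocity `v`. -/
def IsGeodesicFrom (q : M) (v : TangentSpace I q) (c : ℝ → M) : Prop :=
  IsGeodesic I c ∧ c 0 = q ∧ deriv (fun s ↦ extChartAt I q (c s)) 0 = coordVector I q v

/-- The domain of the Riemannian exponential map at `q`. -/
def expDomain (q : M) : Set (TangentSpace I q) :=
  {v | ∃ c : ℝ → M, IsGeodesicFrom I q v c}

open Classical in
/-- The Riemannian exponential map at `q`: the endpoint `c 1` of the geodesic `c` that starts at `q`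
with velocity `v`. Outside `expDomain I q` it takes the junk value `q`. -/
def Exp (q : M) (v : TangentSpace I q) : M :=
  if h : ∃ c : ℝ → M, IsGeodesicFrom I q v c then h.choose 1 else q

/-- `Exp_q` is defined on the open ball of radius `a` around the origin of the tangent space at `q`
and is a diffeomorphism from it onto an open subset of the manifold. -/
def IsDiffeoOnBall (q : M) (a : ℝ) : Prop :=
  Metric.ball (0 : TangentSpace I q) a ⊆ expDomain I q ∧
  ∃ Φ : OpenPartialHomeomorph (TangentSpace I q) M,
    Φ.source = Metric.ball (0 : TangentSpace I q) a ∧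
    EqOn Φ (Exp I q) Φ.source ∧
    ContMDiffOn 𝓘(ℝ, TangentSpace I q) I ∞ Φ Φ.source ∧
    ContMDiffOn I 𝓘(ℝ, TangentSpace I q) ∞ Φ.symm Φ.target

/-- The injectivity radius at `q`: the supremum, in `[0, ∞]`, of the radii `a` for which `Exp_q` is
a diffeomorphism from the open ball of radius `a` onto its image. -/
def injectivityRadius (q : M) : ℝ≥0∞ :=
  ⨆ (a : ℝ≥0) (_ : IsDiffeoOnBall I q a), (a : ℝ≥0∞)

end RiemannianGeometry

end

/-!
Let `f` be the expression of `Exp_q` in a chart. Radial lines are geodesics, so the Hessian `∇df` of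
`f`, taken with the Christoffel symbols of the target, satisfies `∇df_{tv}(v, v) = 0` for small
`t > 0`. Hence `∇df` vanishes at `0`, and so does the full symmetrization of its derivative there.
The Ricci identity then expresses that derivative through the curvature, and the Taylor expansion of
the metric pulled back by `f` becomes

  `|dExp_v w|² = |w|² - ⟨R(w, v)v, w⟩ / 3 + o(|v|²) |w|²`.

Write `Δ = δ e` and `Δ' = δ' (cos s₀ e + sin s₀ n)` with `e, n` orthonormal. By the expansion, the
image of the circular arc `δ (cos s e + sin s n)`, `0 ≤ s ≤ s₀`, has length at most
`s₀ δ (1 - K δ² / 6 + η(δ))`. Its endpoint is joined to `Exp_q Δ'` by a radial geodesic of length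
`|δ - δ'|`. This yields the estimate with `C = 0`.
-/

noncomputable section

set_option maxSynthPendingDepth 3

namespace RiemannianGeometry

section Calculus

variable {𝕜 : Type*} [NontriviallyNormedField 𝕜]
  {X : Type*} [NormedAddCommGroup X] [NormedSpace 𝕜 X]
  {E : Type*} [NormedAddCommGroup E] [NormedSpace 𝕜 E]
  {F : Type*} [NormedAddCommGroup F] [NormedSpace 𝕜 F]
  {G : Type*} [NormedAddCommGroup G] [NormedSpace 𝕜 G] {x : X}

theorem fderiv_clm_apply₂ {B : X → E →L[𝕜] F →L[𝕜] G} {b : X → E} {c : X → F}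
    (hB : DifferentiableAt 𝕜 B x) (hb : DifferentiableAt 𝕜 b x) (hc : DifferentiableAt 𝕜 c x)
    (u : X) :
    fderiv 𝕜 (fun z ↦ B z (b z) (c z)) x u =
      fderiv 𝕜 B x u (b x) (c x) + B x (fderiv 𝕜 b x u) (c x) + B x (b x) (fderiv 𝕜 c x u) := by
  rw [fderiv_clm_apply (hB.clm_apply hb) hc, fderiv_clm_apply hB hb]
  simp only [add_apply, ContinuousLinearMap.comp_apply, ContinuousLinearMap.flip_apply]
  abel

theorem fderiv_clm_apply_const {A : X → E →L[𝕜] F} (hA : DifferentiableAt 𝕜 A x) (u : X) (v : E) :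
    fderiv 𝕜 (fun z ↦ A z v) x u = fderiv 𝕜 A x u v := by
  simp [fderiv_clm_apply hA (differentiableAt_const v)]

theorem fderiv_clm_apply_const₂ {B : X → E →L[𝕜] F →L[𝕜] G} (hB : DifferentiableAt 𝕜 B x)
    (u : X) (v : E) (w : F) :
    fderiv 𝕜 (fun z ↦ B z v w) x u = fderiv 𝕜 B x u v w := by
  rw [fderiv_clm_apply_const (by fun_prop), fderiv_clm_apply_const hB]

theorem fderiv_apply_comm {B : X → E →L[𝕜] E →L[𝕜] G} (hB : DifferentiableAt 𝕜 B x) {v w : E}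
    (h : ∀ᶠ z in 𝓝 x, B z v w = B z w v) (u : X) :
    fderiv 𝕜 B x u v w = fderiv 𝕜 B x u w v := by
  rw [← fderiv_clm_apply_const₂ hB, ← fderiv_clm_apply_const₂ hB, Filter.EventuallyEq.fderiv_eq h]

theorem contDiffAt_bilinearComp {E' : Type*} [NormedAddCommGroup E'] [NormedSpace 𝕜 E']
    {F' : Type*} [NormedAddCommGroup F'] [NormedSpace 𝕜 F'] {n : ℕ∞ω}
    {B : X → E →L[𝕜] F →L[𝕜] G} {a : X → E' →L[𝕜] E} {b : X → F' →L[𝕜] F}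
    (hB : ContDiffAt 𝕜 n B x) (ha : ContDiffAt 𝕜 n a x) (hb : ContDiffAt 𝕜 n b x) :
    ContDiffAt 𝕜 n (fun z ↦ (B z).bilinearComp (a z) (b z)) x := by
  have hflip : ContDiffAt 𝕜 n (fun z ↦ ((B z).comp (a z)).flip) x :=
    (ContinuousLinearMap.flipₗᵢ 𝕜 E' F G).contDiff.contDiffAt.comp x (hB.clm_comp ha)
  exact (ContinuousLinearMap.flipₗᵢ 𝕜 F' E' G).contDiff.contDiffAt.comp x (hflip.clm_comp hb)

theorem hasDerivAt_comp_smul {f : X → F} {t : 𝕜} {v : X} (hf : DifferentiableAt 𝕜 f (t • v)) :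
    HasDerivAt (fun s : 𝕜 ↦ f (s • v)) (fderiv 𝕜 f (t • v) v) t := by
  have hline : HasDerivAt (fun s : 𝕜 ↦ s • v) v t := by
    simpa using (hasDerivAt_id t).smul_const v
  exact hf.hasFDerivAt.comp_hasDerivAt t hline

end Calculus

theorem taylor_two_isLittleO {V F : Type*} [NormedAddCommGroup V] [NormedSpace ℝ V]
    [NormedAddCommGroup F] [NormedSpace ℝ F] {f : V → F} (hf : ContDiffAt ℝ 2 f 0) :
    (fun v ↦ f v - f 0 - fderiv ℝ f 0 v - (1 / 2 : ℝ) • fderiv ℝ (fderiv ℝ f) 0 v v)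
      =o[𝓝 0] fun v ↦ ‖v‖ ^ 2 := by
  have hf' : ContDiffAt ℝ 1 (fderiv ℝ f) 0 := hf.fderiv_right (by norm_num)
  obtain ⟨r, hr, hball⟩ := Metric.eventually_nhds_iff_ball.1 (hf.eventually (by simp))
  have hsymm (v w : V) : fderiv ℝ (fderiv ℝ f) 0 v w = fderiv ℝ (fderiv ℝ f) 0 w v :=
    (hf.isSymmSndFDerivAt (by simp)).eq v w
  set D := fderiv ℝ (fderiv ℝ f) 0
  have hderiv : ∀ v ∈ Metric.ball (0 : V) r, HasFDerivWithinAt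
      (fun v ↦ f v - fderiv ℝ f 0 v - (1 / 2 : ℝ) • D v v) (fderiv ℝ f v - fderiv ℝ f 0 - D v)
      (Metric.ball 0 r) v := by
    intro v hv
    have hquad : HasFDerivAt (fun v ↦ (1 / 2 : ℝ) • D v v) (D v) v := by
      refine ((D.hasFDerivAt.clm_apply (hasFDerivAt_id v)).const_smul (1 / 2 : ℝ)).congr_fderiv ?_
      ext w
      simp only [add_apply, smul_apply, ContinuousLinearMap.comp_apply,
        ContinuousLinearMap.flip_apply, ContinuousLinearMap.id_apply, id_eq, hsymm w v]
      module
    exact ((((hball v hv).differentiableAt two_ne_zero).hasFDerivAt.sub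
      (fderiv ℝ f 0).hasFDerivAt).sub hquad).hasFDerivWithinAt
  have hlittle : (fun v ↦ fderiv ℝ f v - fderiv ℝ f 0 - D v) =o[𝓝[Metric.ball 0 r] 0]
      fun v ↦ ‖v - 0‖ ^ 1 := by
    simpa only [sub_zero, pow_one] using
      ((hf'.differentiableAt one_ne_zero).hasFDerivAt.isLittleO.mono nhdsWithin_le_nhds).norm_right
  have h := (convex_ball (0 : V) r).isLittleO_pow_succ (Metric.mem_ball_self hr) hderiv hlittle
  rw [nhdsWithin_eq_nhds.2 (Metric.ball_mem_nhds 0 hr)] at h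
  refine h.congr (fun v ↦ ?_) fun v ↦ by simp
  simp only [map_zero, smul_zero, sub_zero]
  abel

section Coordinates

variable {E : Type*} [NormedAddCommGroup E] [NormedSpace ℝ E]

/-- The function `g` is a `C²` pseudo-Riemannian metric in coordinates on the open set `U`: its
values are nondegenerate symmetric bilinear forms, not assumed to be positive. -/
structure IsMetricOn (g : E → E →L[ℝ] E →L[ℝ] ℝ) (U : Set E) : Prop where
  isOpen : IsOpen U
  contDiffOn : ContDiffOn ℝ 2 g U
  symm : ∀ y ∈ U, ∀ u v, g y u v = g y v u
  isInvertible : ∀ y ∈ U, (g y).IsInvertible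

/-- The Koszul form `(u, v, w) ↦ (D u v w + D v u w - D w u v) / 2` of the derivative `D` of a
metric, as a continuous linear function of `D`; compare `christoffelForm`. -/
def koszulForm : (E →L[ℝ] E →L[ℝ] E →L[ℝ] ℝ) →L[ℝ] E →L[ℝ] E →L[ℝ] E →L[ℝ] ℝ :=
  let σ : (E →L[ℝ] E →L[ℝ] E →L[ℝ] ℝ) →L[ℝ] E →L[ℝ] E →L[ℝ] E →L[ℝ] ℝ :=
    ContinuousLinearMap.flipₗᵢ ℝ E E (E →L[ℝ] ℝ)
  let τ : (E →L[ℝ] E →L[ℝ] E →L[ℝ] ℝ) →L[ℝ] E →L[ℝ] E →L[ℝ] E →L[ℝ] ℝ :=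
    ContinuousLinearMap.postcomp E (ContinuousLinearMap.flipₗᵢ ℝ E E ℝ)
  (1 / 2 : ℝ) • (.id ℝ _ + σ - τ ∘L σ)

/-- The Christoffel symbols `christoffel g y` at `y` bundled as a continuous bilinear map, which can
be differentiated in `y`. -/
def christoffelCLM (g : E → E →L[ℝ] E →L[ℝ] ℝ) (y : E) : E →L[ℝ] E →L[ℝ] E :=
  (ContinuousLinearMap.compL ℝ E (E →L[ℝ] ℝ) E (g y).inverse) ∘L koszulForm (fderiv ℝ g y)

theorem christoffelCLM_apply (g : E → E →L[ℝ] E →L[ℝ] ℝ) (y u v : E) :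
    christoffelCLM g y u v = christoffel g y u v := rfl

variable {g : E → E →L[ℝ] E →L[ℝ] ℝ} {U : Set E} {y : E}

namespace IsMetricOn

theorem contDiffAt (hg : IsMetricOn g U) (hy : y ∈ U) : ContDiffAt ℝ 2 g y :=
  hg.contDiffOn.contDiffAt (hg.isOpen.mem_nhds hy)

theorem differentiableAt (hg : IsMetricOn g U) (hy : y ∈ U) : DifferentiableAt ℝ g y :=
  (hg.contDiffAt hy).differentiableAt two_ne_zero

theorem contDiffAt_fderiv (hg : IsMetricOn g U) (hy : y ∈ U) : ContDiffAt ℝ 1 (fderiv ℝ g) y :=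
  (hg.contDiffAt hy).fderiv_right (by norm_num)

theorem contDiffAt_christoffelCLM [CompleteSpace E] (hg : IsMetricOn g U) (hy : y ∈ U) :
    ContDiffAt ℝ 1 (christoffelCLM g) y := by
  have hinv : ContDiffAt ℝ 1 (fun z ↦ (g z).inverse) y :=
    (hg.isInvertible y hy).contDiffAt_map_inverse.comp y ((hg.contDiffAt hy).of_le one_le_two)
  have hkoszul : ContDiffAt ℝ 1 (fun z ↦ koszulForm (fderiv ℝ g z)) y :=
    koszulForm.contDiff.contDiffAt.comp y (hg.contDiffAt_fderiv hy)
  exact ((ContinuousLinearMap.compL ℝ E (E →L[ℝ] ℝ) E).contDiff.contDiffAt.comp y hinv).clm_comp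
    hkoszul

theorem differentiableAt_christoffelCLM [CompleteSpace E] (hg : IsMetricOn g U) (hy : y ∈ U) :
    DifferentiableAt ℝ (christoffelCLM g) y :=
  (hg.contDiffAt_christoffelCLM hy).differentiableAt one_ne_zero

theorem fderiv_comm (hg : IsMetricOn g U) (hy : y ∈ U) (u v w : E) :
    fderiv ℝ g y u v w = fderiv ℝ g y u w v :=
  fderiv_apply_comm (hg.differentiableAt hy)
    (Filter.mem_of_superset (hg.isOpen.mem_nhds hy) fun z hz ↦ hg.symm z hz v w) u

theorem apply_christoffelCLM (hg : IsMetricOn g U) (hy : y ∈ U) (u v w : E) :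
    g y (christoffelCLM g y u v) w =
      (fderiv ℝ g y u v w + fderiv ℝ g y v u w - fderiv ℝ g y w u v) / 2 := by
  have h : g y (christoffelCLM g y u v) = christoffelForm g y u v := by
    obtain ⟨e, he⟩ := hg.isInvertible y hy
    simp [christoffelCLM_apply, christoffel, ← he]
  simp only [h, christoffelForm, smul_apply, sub_apply, add_apply, ContinuousLinearMap.flip_apply,
    smul_eq_mul]
  ring

theorem christoffelCLM_comm (hg : IsMetricOn g U) (hy : y ∈ U) (u v : E) :
    christoffelCLM g y u v = christoffelCLM g y v u := by
  obtain ⟨e, he⟩ := hg.isInvertible y hy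
  refine e.injective (ContinuousLinearMap.ext fun w ↦ ?_)
  have happly (z : E) : e z = g y z := by rw [← he, ContinuousLinearEquiv.coe_coe]
  rw [happly, happly, hg.apply_christoffelCLM hy, hg.apply_christoffelCLM hy, hg.fderiv_comm hy w,
    add_comm (fderiv ℝ g y u v w)]

/-- The Levi-Civita connection is compatible with the metric. -/
theorem fderiv_eq (hg : IsMetricOn g U) (hy : y ∈ U) (u v w : E) :
    fderiv ℝ g y u v w = g y (christoffelCLM g y u v) w + g y v (christoffelCLM g y u w) := by
  rw [hg.symm y hy v, hg.apply_christoffelCLM hy, hg.apply_christoffelCLM hy,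
    hg.fderiv_comm hy u w v, hg.fderiv_comm hy v u w, hg.fderiv_comm hy w u v]
  ring

theorem curvature_eq [CompleteSpace E] (hg : IsMetricOn g U) (hy : y ∈ U) (u v w : E) :
    curvature g y u v w =
      fderiv ℝ (christoffelCLM g) y u v w - fderiv ℝ (christoffelCLM g) y v u w
        + christoffelCLM g y u (christoffelCLM g y v w)
        - christoffelCLM g y v (christoffelCLM g y u w) := by
  simp only [← fderiv_clm_apply_const₂ (hg.differentiableAt_christoffelCLM hy)]
  rfl

theorem fderiv_fderiv_eq [CompleteSpace E] (hg : IsMetricOn g U) (hy : y ∈ U) (u v a b : E) :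
    fderiv ℝ (fderiv ℝ g) y u v a b =
      fderiv ℝ g y u (christoffelCLM g y v a) b + g y (fderiv ℝ (christoffelCLM g) y u v a) b
      + (fderiv ℝ g y u a (christoffelCLM g y v b)
        + g y a (fderiv ℝ (christoffelCLM g) y u v b)) := by
  have hΓ := hg.differentiableAt_christoffelCLM hy
  have hΓ' (c : E) : DifferentiableAt ℝ (fun z ↦ christoffelCLM g z v c) y := by fun_prop
  have hD := (hg.contDiffAt_fderiv hy).differentiableAt one_ne_zero
  have hgy := hg.differentiableAt hy
  have hcompat : (fun z ↦ fderiv ℝ g z v a b) =ᶠ[𝓝 y] fun z ↦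
      g z (christoffelCLM g z v a) b + g z a (christoffelCLM g z v b) :=
    Filter.mem_of_superset (hg.isOpen.mem_nhds hy) fun z hz ↦ hg.fderiv_eq hz v a b
  have hleft : fderiv ℝ (fun z ↦ fderiv ℝ g z v a b) y u = fderiv ℝ (fderiv ℝ g) y u v a b := by
    rw [fderiv_clm_apply_const₂ (B := fun z ↦ fderiv ℝ g z v) (by fun_prop),
      fderiv_clm_apply_const hD]
  rw [← hleft, hcompat.fderiv_eq, fderiv_fun_add (by fun_prop) (by fun_prop), add_apply,
    fderiv_clm_apply₂ hgy (hΓ' a) (differentiableAt_const b),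
    fderiv_clm_apply₂ hgy (differentiableAt_const a) (hΓ' b),
    fderiv_clm_apply_const₂ hΓ, fderiv_clm_apply_const₂ hΓ]
  simp

theorem curvature_skew [CompleteSpace E] (hg : IsMetricOn g U) (hy : y ∈ U) (u v a b : E) :
    g y (curvature g y u v a) b = - g y (curvature g y u v b) a := by
  have hcomm : fderiv ℝ (fderiv ℝ g) y u v a b = fderiv ℝ (fderiv ℝ g) y v u a b :=
    congrArg (fun A ↦ A a b) (((hg.contDiffAt hy).isSymmSndFDerivAt (by simp)).eq u v)
  simp only [hg.fderiv_fderiv_eq hy, hg.fderiv_eq hy] at hcomm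
  simp only [hg.curvature_eq hy, map_add, map_sub, add_apply, sub_apply, hg.symm y hy _ a]
  linarith

end IsMetricOn

/-- The curvature biquadratic form `⟨R(u, v)v, u⟩` at `y` of a metric `g` given in coordinates: the
numerator of `coordSectionalCurvature`. -/
def coordCurvatureForm (g : E → E →L[ℝ] E →L[ℝ] ℝ) (y u v : E) : ℝ :=
  g y (curvature g y u v v) u

theorem IsMetricOn.coordCurvatureForm_basis_change [CompleteSpace E] (hg : IsMetricOn g U)
    (hy : y ∈ U) (u v : E) (a b c d : ℝ) :
    coordCurvatureForm g y (a • u + b • v) (c • u + d • v) =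
      (a * d - b * c) ^ 2 * coordCurvatureForm g y u v := by
  have halternating (w : E) : curvature g y (a • u + b • v) (c • u + d • v) w =
      (a * d - b * c) • curvature g y u v w := by
    simp only [hg.curvature_eq hy, map_add, map_smul, add_apply, smul_apply]
    module
  have hlinear : curvature g y u v (c • u + d • v) =
      c • curvature g y u v u + d • curvature g y u v v := by
    simp only [hg.curvature_eq hy, map_add, map_smul]
    module
  have hskew := hg.curvature_skew hy u v
  have hself (w : E) : g y (curvature g y u v w) w = 0 := by linarith [hskew w w]
  simp only [coordCurvatureForm, halternating, hlinear, map_add, map_smul, add_apply, smul_apply,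
    smul_eq_mul, hskew u v, hself]
  ring

end Coordinates

section NormalMap

variable {E : Type*} [NormedAddCommGroup E] [NormedSpace ℝ E]
  {V : Type*} [NormedAddCommGroup V] [NormedSpace ℝ V]

/-- The Hessian `∇df` at `z` of a map `f` into coordinates carrying the metric `g`: in coordinates
`∇df(a, b) = f''(a, b) + Γ(f' a, f' b)`. It vanishes on `(v, v)` along the line `t ↦ z + t v`
exactly when `f` maps this line to a geodesic. -/
def hessian (g : E → E →L[ℝ] E →L[ℝ] ℝ) (f : V → E) (z : V) : V →L[ℝ] V →L[ℝ] E :=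
  fderiv ℝ (fderiv ℝ f) z + (christoffelCLM g (f z)).bilinearComp (fderiv ℝ f z) (fderiv ℝ f z)

theorem hessian_apply (g : E → E →L[ℝ] E →L[ℝ] ℝ) (f : V → E) (z a b : V) :
    hessian g f z a b =
      fderiv ℝ (fderiv ℝ f) z a b + christoffelCLM g (f z) (fderiv ℝ f z a) (fderiv ℝ f z b) :=
  rfl

/-- The pullback `f^* g` at `z` of a metric `g` given in coordinates. -/
def pullback (g : E → E →L[ℝ] E →L[ℝ] ℝ) (f : V → E) (z : V) : V →L[ℝ] V →L[ℝ] ℝ :=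
  (g (f z)).bilinearComp (fderiv ℝ f z) (fderiv ℝ f z)

theorem pullback_apply (g : E → E →L[ℝ] E →L[ℝ] ℝ) (f : V → E) (z a b : V) :
    pullback g f z a b = g (f z) (fderiv ℝ f z a) (fderiv ℝ f z b) := rfl

namespace IsMetricOn

variable {g : E → E →L[ℝ] E →L[ℝ] ℝ} {U : Set E} {f : V → E} {z : V}

theorem contDiffAt_pullback (hg : IsMetricOn g U) (hz : f z ∈ U) (hf : ContDiffAt ℝ 3 f z) :
    ContDiffAt ℝ 2 (pullback g f) z := by
  have hf' : ContDiffAt ℝ 2 (fderiv ℝ f) z := hf.fderiv_right (by norm_num)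
  exact contDiffAt_bilinearComp ((hg.contDiffAt hz).comp z (hf.of_le (by norm_num))) hf' hf'

theorem contDiffAt_hessian [CompleteSpace E] (hg : IsMetricOn g U) (hz : f z ∈ U)
    (hf : ContDiffAt ℝ 3 f z) : ContDiffAt ℝ 1 (hessian g f) z := by
  have hf' : ContDiffAt ℝ 2 (fderiv ℝ f) z := hf.fderiv_right (by norm_num)
  have hf'₁ := hf'.of_le one_le_two
  exact (hf'.fderiv_right (by norm_num)).add (contDiffAt_bilinearComp
    ((hg.contDiffAt_christoffelCLM hz).comp z (hf.of_le (by norm_num))) hf'₁ hf'₁)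

theorem hessian_comm (hg : IsMetricOn g U) (hz : f z ∈ U) (hf : ContDiffAt ℝ 2 f z) (a b : V) :
    hessian g f z a b = hessian g f z b a := by
  rw [hessian_apply, hessian_apply, (hf.isSymmSndFDerivAt (by simp)).eq a b,
    hg.christoffelCLM_comm hz]

theorem fderiv_pullback (hg : IsMetricOn g U) (hz : f z ∈ U) (hf : ContDiffAt ℝ 2 f z)
    (a b c : V) :
    fderiv ℝ (pullback g f) z a b c =
      g (f z) (hessian g f z a b) (fderiv ℝ f z c)
        + g (f z) (fderiv ℝ f z b) (hessian g f z a c) := by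
  have hdf : DifferentiableAt ℝ f z := hf.differentiableAt two_ne_zero
  have hdf' : DifferentiableAt ℝ (fderiv ℝ f) z :=
    (hf.fderiv_right (m := 1) (by norm_num)).differentiableAt one_ne_zero
  have hdg := hg.differentiableAt hz
  have hgf : DifferentiableAt ℝ (fun z ↦ g (f z)) z := hdg.comp z hdf
  have hpullback : DifferentiableAt ℝ (pullback g f) z :=
    (contDiffAt_bilinearComp (n := 1) (((hg.contDiffAt hz).comp z hf).of_le one_le_two)
      (hf.fderiv_right (by norm_num)) (hf.fderiv_right (by norm_num))).differentiableAt one_ne_zero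
  rw [← fderiv_clm_apply_const₂ hpullback]
  simp only [pullback_apply]
  rw [fderiv_clm_apply₂ hgf (by fun_prop) (by fun_prop), fderiv_clm_apply_const hdf',
    fderiv_clm_apply_const hdf', show fderiv ℝ (fun z ↦ g (f z)) z = _ from fderiv_comp z hdg hdf,
    ContinuousLinearMap.comp_apply, hg.fderiv_eq hz]
  simp only [hessian_apply, map_add, add_apply]
  ring

theorem fderiv_hessian [CompleteSpace E] (hg : IsMetricOn g U) (hz : f z ∈ U)
    (hf : ContDiffAt ℝ 3 f z) (a b c : V) :
    fderiv ℝ (hessian g f) z a b c =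
      fderiv ℝ (fderiv ℝ (fderiv ℝ f)) z a b c
        + (fderiv ℝ (christoffelCLM g) (f z) (fderiv ℝ f z a) (fderiv ℝ f z b) (fderiv ℝ f z c)
        + christoffelCLM g (f z) (fderiv ℝ (fderiv ℝ f) z a b) (fderiv ℝ f z c)
        + christoffelCLM g (f z) (fderiv ℝ f z b) (fderiv ℝ (fderiv ℝ f) z a c)) := by
  have hdf : DifferentiableAt ℝ f z := hf.differentiableAt three_ne_zero
  have hf' : ContDiffAt ℝ 2 (fderiv ℝ f) z := hf.fderiv_right (by norm_num)
  have hdf' : DifferentiableAt ℝ (fderiv ℝ f) z := hf'.differentiableAt two_ne_zero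
  have hdf'' : DifferentiableAt ℝ (fderiv ℝ (fderiv ℝ f)) z :=
    (hf'.fderiv_right (m := 1) (by norm_num)).differentiableAt one_ne_zero
  have hdΓ := hg.differentiableAt_christoffelCLM hz
  have hΓf : DifferentiableAt ℝ (fun z ↦ christoffelCLM g (f z)) z := hdΓ.comp z hdf
  rw [← fderiv_clm_apply_const₂ ((hg.contDiffAt_hessian hz hf).differentiableAt one_ne_zero)]
  simp only [hessian_apply]
  rw [fderiv_fun_add (by fun_prop) (by fun_prop), add_apply, fderiv_clm_apply_const₂ hdf'',
    fderiv_clm_apply₂ hΓf (by fun_prop) (by fun_prop), fderiv_clm_apply_const hdf',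
    fderiv_clm_apply_const hdf',
    show fderiv ℝ (fun z ↦ christoffelCLM g (f z)) z = _ from fderiv_comp z hdΓ hdf,
    ContinuousLinearMap.comp_apply]

/-- The Ricci identity for `df`. -/
theorem fderiv_hessian_sub [CompleteSpace E] (hg : IsMetricOn g U) (hz : f z ∈ U)
    (hf : ContDiffAt ℝ 3 f z) (a b c : V) :
    (fderiv ℝ (hessian g f) z a b c
        + christoffelCLM g (f z) (fderiv ℝ f z a) (hessian g f z b c))
      - (fderiv ℝ (hessian g f) z b a c
        + christoffelCLM g (f z) (fderiv ℝ f z b) (hessian g f z a c)) =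
      curvature g (f z) (fderiv ℝ f z a) (fderiv ℝ f z b) (fderiv ℝ f z c) := by
  have hf₂ : ContDiffAt ℝ 2 f z := hf.of_le (by norm_num)
  have hf' : ContDiffAt ℝ 2 (fderiv ℝ f) z := hf.fderiv_right (by norm_num)
  rw [hg.fderiv_hessian hz hf, hg.fderiv_hessian hz hf, hg.curvature_eq hz,
    (hf'.isSymmSndFDerivAt (by simp)).eq a b, (hf₂.isSymmSndFDerivAt (by simp)).eq a b]
  simp only [hessian_apply, map_add]
  abel

end IsMetricOn

/-- The map `f` is normal at the origin: it is `C³` there and maps the beginnings of the rays from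
the origin to geodesics of the metric `g`. The metric in the coordinates given by `f` is then the
metric in normal coordinates, up to a linear change of coordinates. -/
structure IsNormalMap (g : E → E →L[ℝ] E →L[ℝ] ℝ) (U : Set E) (f : V → E) : Prop where
  metric : IsMetricOn g U
  zero_mem : f 0 ∈ U
  contDiffAt : ContDiffAt ℝ 3 f 0
  hessian_self : ∀ v, ∀ᶠ t : ℝ in 𝓝[>] 0, hessian g f (t • v) v v = 0

namespace IsNormalMap

variable {g : E → E →L[ℝ] E →L[ℝ] ℝ} {U : Set E} {f : V → E} [CompleteSpace E]

theorem contDiffAt_hessian (h : IsNormalMap g U f) : ContDiffAt ℝ 1 (hessian g f) 0 :=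
  h.metric.contDiffAt_hessian h.zero_mem h.contDiffAt

theorem hasDerivAt_hessian (h : IsNormalMap g U f) (v a b : V) :
    HasDerivAt (fun t : ℝ ↦ hessian g f (t • v) a b) (fderiv ℝ (hessian g f) 0 v a b) 0 := by
  have hhessian := h.contDiffAt_hessian.differentiableAt one_ne_zero
  have hray := hasDerivAt_comp_smul (f := fun z ↦ hessian g f z a b) (t := (0 : ℝ)) (v := v)
    (by rw [zero_smul]; fun_prop)
  rwa [zero_smul, fderiv_clm_apply_const₂ hhessian] at hray

theorem hessian_zero_self (h : IsNormalMap g U f) (v : V) : hessian g f 0 v v = 0 := by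
  have hlim := (h.hasDerivAt_hessian v v v).continuousAt.tendsto.mono_left
    (nhdsWithin_le_nhds (s := Ioi 0))
  rw [zero_smul] at hlim
  exact tendsto_nhds_unique hlim (tendsto_const_nhds.congr'
    (Filter.EventuallyEq.symm (h.hessian_self v)))

theorem hessian_zero (h : IsNormalMap g U f) : hessian g f 0 = 0 := by
  ext v w
  have hadd := h.hessian_zero_self (v + w)
  simp only [map_add, add_apply, h.hessian_zero_self, zero_add, add_zero,
    h.metric.hessian_comm h.zero_mem (h.contDiffAt.of_le (by norm_num)) w v] at hadd
  simpa using (two_smul ℝ (hessian g f 0 v w)).trans hadd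

theorem fderiv_hessian_self (h : IsNormalMap g U f) (v : V) :
    fderiv ℝ (hessian g f) 0 v v v = 0 := by
  refine (uniqueDiffWithinAt_Ioi (0 : ℝ)).eq_deriv _ (h.hasDerivAt_hessian v v v).hasDerivWithinAt
    ((hasDerivWithinAt_const (0 : ℝ) (Ioi 0) (0 : E)).congr_of_eventuallyEq (h.hessian_self v) ?_)
  rw [zero_smul, h.hessian_zero_self]

theorem fderiv_hessian_comm (h : IsNormalMap g U f) (u v w : V) :
    fderiv ℝ (hessian g f) 0 u v w = fderiv ℝ (hessian g f) 0 u w v := by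
  refine fderiv_apply_comm (h.contDiffAt_hessian.differentiableAt one_ne_zero) ?_ u
  filter_upwards [h.contDiffAt.eventually (by simp),
    h.contDiffAt.continuousAt.eventually_mem (h.metric.isOpen.mem_nhds h.zero_mem)] with z hz hzU
  exact h.metric.hessian_comm hzU (hz.of_le (by norm_num)) v w

/-- Polarizing `fderiv_hessian_self` expresses the derivative along `w` through the one along `v`,
and their difference is the curvature. -/
theorem fderiv_hessian_eq_curvature (h : IsNormalMap g U f) (v w : V) :
    fderiv ℝ (hessian g f) 0 v v w =
      -(1 / 3 : ℝ) • curvature g (f 0) (fderiv ℝ f 0 w) (fderiv ℝ f 0 v) (fderiv ℝ f 0 v) := by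
  have hpolar : fderiv ℝ (hessian g f) 0 w v v = -(2 : ℝ) • fderiv ℝ (hessian g f) 0 v v w := by
    have hadd := h.fderiv_hessian_self (v + w)
    have hsub := h.fderiv_hessian_self (v - w)
    simp only [map_add, map_sub, add_apply, sub_apply, h.fderiv_hessian_self,
      h.fderiv_hessian_comm _ w v] at hadd hsub
    linear_combination (norm := module) (1 / 2 : ℝ) • (hadd - hsub)
  have hricci := h.metric.fderiv_hessian_sub h.zero_mem h.contDiffAt w v v
  simp only [h.hessian_zero, zero_apply, map_zero, add_zero, hpolar,
    h.fderiv_hessian_comm v w v] at hricci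
  rw [← hricci]
  module

theorem fderiv_pullback_zero (h : IsNormalMap g U f) : fderiv ℝ (pullback g f) 0 = 0 := by
  ext a b c
  rw [h.metric.fderiv_pullback h.zero_mem (h.contDiffAt.of_le (by norm_num)), h.hessian_zero]
  simp

theorem fderiv_fderiv_pullback_zero (h : IsNormalMap g U f) (v w : V) :
    fderiv ℝ (fderiv ℝ (pullback g f)) 0 v v w w =
      -(2 / 3) * coordCurvatureForm g (f 0) (fderiv ℝ f 0 w) (fderiv ℝ f 0 v) := by
  have hdf : DifferentiableAt ℝ f 0 := h.contDiffAt.differentiableAt three_ne_zero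
  have hdf' : DifferentiableAt ℝ (fderiv ℝ f) 0 :=
    (h.contDiffAt.fderiv_right (m := 2) (by norm_num)).differentiableAt two_ne_zero
  have hgf : DifferentiableAt ℝ (fun z ↦ g (f z)) 0 :=
    (h.metric.differentiableAt h.zero_mem).comp 0 hdf
  have hhessian := h.contDiffAt_hessian.differentiableAt one_ne_zero
  have hpullback : DifferentiableAt ℝ (fderiv ℝ (pullback g f)) 0 :=
    ((h.metric.contDiffAt_pullback h.zero_mem h.contDiffAt).fderiv_right
      (m := 1) (by norm_num)).differentiableAt one_ne_zero
  have hfirst : (fun z ↦ fderiv ℝ (pullback g f) z v w w) =ᶠ[𝓝 0]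
      fun z ↦ (2 : ℝ) • g (f z) (hessian g f z v w) (fderiv ℝ f z w) := by
    filter_upwards [h.contDiffAt.eventually (by simp),
      h.contDiffAt.continuousAt.eventually_mem (h.metric.isOpen.mem_nhds h.zero_mem)] with z hz hzU
    rw [h.metric.fderiv_pullback hzU (hz.of_le (by norm_num)),
      h.metric.symm _ hzU (fderiv ℝ f z w), smul_eq_mul, two_mul]
  have hsecond : fderiv ℝ (fun z ↦ fderiv ℝ (pullback g f) z v w w) 0 v =
      fderiv ℝ (fderiv ℝ (pullback g f)) 0 v v w w := by
    rw [fderiv_clm_apply_const₂ (B := fun z ↦ fderiv ℝ (pullback g f) z v) (by fun_prop),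
      fderiv_clm_apply_const hpullback]
  have hhessian_vw : DifferentiableAt ℝ (fun z ↦ hessian g f z v w) 0 := by fun_prop
  rw [← hsecond, hfirst.fderiv_eq,
    fderiv_fun_const_smul ((hgf.clm_apply hhessian_vw).clm_apply (by fun_prop)), smul_apply,
    fderiv_clm_apply₂ hgf hhessian_vw (by fun_prop), fderiv_clm_apply_const₂ hhessian,
    h.hessian_zero, h.fderiv_hessian_eq_curvature, coordCurvatureForm]
  simp only [zero_apply, map_zero, one_div, neg_smul, map_neg, map_smul, neg_apply, smul_apply,
    smul_eq_mul, zero_add, add_zero, mul_neg, neg_mul, neg_inj]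
  ring

theorem pullback_expansion (h : IsNormalMap g U f) {ε : ℝ} (hε : 0 < ε) :
    ∀ᶠ v in 𝓝 0, ∀ w,
      |pullback g f v w w - pullback g f 0 w w
        + 1 / 3 * coordCurvatureForm g (f 0) (fderiv ℝ f 0 w) (fderiv ℝ f 0 v)|
        ≤ ε * ‖v‖ ^ 2 * ‖w‖ ^ 2 := by
  have htaylor :=
    taylor_two_isLittleO (h.metric.contDiffAt_pullback h.zero_mem h.contDiffAt)
  filter_upwards [htaylor.def hε] with v hv w
  have hw := ContinuousLinearMap.le_of_opNorm_le _ (ContinuousLinearMap.le_of_opNorm_le _ hv w) w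
  simp only [sub_apply, smul_apply, h.fderiv_pullback_zero, zero_apply, sub_zero,
    h.fderiv_fderiv_pullback_zero, Real.norm_eq_abs, smul_eq_mul, abs_pow, abs_norm] at hw
  calc
    _ = _ := by congr 1; ring
    _ ≤ _ := hw
    _ = _ := by ring

end IsNormalMap

end NormalMap

section ChartMetric

variable {E : Type*} [NormedAddCommGroup E] [NormedSpace ℝ E]
  {H : Type*} [TopologicalSpace H] {I : ModelWithCorners ℝ E H}
  {M : Type*} [TopologicalSpace M] [ChartedSpace H M] [IsManifold I ∞ M] {q x : M} {y : E}

theorem coordVector_smul (q : M) (a : ℝ) (v : TangentSpace I q) :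
    coordVector I q (a • v) = a • coordVector I q v :=
  map_smul _ a v

theorem coordVector_add (q : M) (v w : TangentSpace I q) :
    coordVector I q (v + w) = coordVector I q v + coordVector I q w :=
  map_add _ v w

theorem continuous_coordVector (q : M) : Continuous (coordVector I q) :=
  ContinuousLinearMap.continuous _

theorem extChartAt_symm_mem_baseSet (hy : y ∈ (extChartAt I q).target) :
    (extChartAt I q).symm y ∈ (trivializationAt E (TangentSpace I : M → Type _) q).baseSet := by
  simpa using (extChartAt I q).map_target hy

theorem contDiffAt_extChartAt_comp {V : Type*} [NormedAddCommGroup V] [NormedSpace ℝ V]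
    {F : V → M} {v : V} (hF : ContMDiffAt 𝓘(ℝ, V) I ∞ F v) (hx : F v ∈ (extChartAt I q).source) :
    ContDiffAt ℝ ∞ (fun z ↦ extChartAt I q (F z)) v := by
  rw [extChartAt_source] at hx
  exact ((contMDiffAt_extChartAt' hx).comp v hF).contDiffAt

theorem continuousLinearMapAt_mfderiv {V : Type*} [NormedAddCommGroup V] [NormedSpace ℝ V]
    {F : V → M} {v : V} (hF : MDifferentiableAt 𝓘(ℝ, V) I F v)
    (hx : F v ∈ (extChartAt I q).source) (w : V) :
    (trivializationAt E (TangentSpace I : M → Type _) q).continuousLinearMapAt ℝ (F v)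
      (mfderiv 𝓘(ℝ, V) I F v w) = fderiv ℝ (fun z ↦ extChartAt I q (F z)) v w := by
  rw [extChartAt_source] at hx
  rw [TangentBundle.continuousLinearMapAt_trivializationAt hx]
  have hchain := mfderiv_comp v (mdifferentiableAt_extChartAt (I := I) hx) hF
  rw [mfderiv_eq_fderiv] at hchain
  exact (congrArg (fun A ↦ A w) hchain).symm

theorem isInvertible_of_injective [FiniteDimensional ℝ E] {A : E →L[ℝ] E →L[ℝ] ℝ}
    (hA : Function.Injective A) : A.IsInvertible := by
  have hfinrank : Module.finrank ℝ E = Module.finrank ℝ (E →L[ℝ] ℝ) := by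
    rw [← (LinearMap.toContinuousLinearMap (𝕜 := ℝ) (E := E) (F' := ℝ)).finrank_eq]
    exact (Subspace.dual_finrank_eq (K := ℝ) (V := E)).symm
  let e := LinearEquiv.ofInjectiveOfFinrankEq (A : E →ₗ[ℝ] E →L[ℝ] ℝ) hA hfinrank
  exact ⟨e.toContinuousLinearEquiv, rfl⟩

variable [RiemannianBundle (fun x : M ↦ TangentSpace I x)]

theorem chartMetric_symm (q : M) (y u v : E) :
    chartMetric I q y u v = chartMetric I q y v u := by
  rw [chartMetric_apply, chartMetric_apply, real_inner_comm]

theorem chartMetric_self_pos (hy : y ∈ (extChartAt I q).target) {u : E} (hu : u ≠ 0) :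
    0 < chartMetric I q y u u := by
  rw [chartMetric_apply, real_inner_self_pos]
  intro hsymm
  apply hu
  rw [← (trivializationAt E (TangentSpace I : M → Type _) q).continuousLinearMapAt_symmL
    (R := ℝ) (extChartAt_symm_mem_baseSet hy) u, hsymm, map_zero]

theorem contDiffOn_chartMetric_apply
    [IsContMDiffRiemannianBundle I ∞ E (fun x : M ↦ TangentSpace I x)] (q : M) (u v : E) :
    ContDiffOn ℝ ∞ (fun y ↦ chartMetric I q y u v) (extChartAt I q).target := by
  let frame (u y : E) : TangentSpace I ((extChartAt I q).symm y) :=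
    (trivializationAt E (TangentSpace I : M → Type _) q).symmL ℝ ((extChartAt I q).symm y) u
  have hframe (u : E) : ContMDiffOn 𝓘(ℝ, E) (I.prod 𝓘(ℝ, E)) ∞
      (fun y ↦ (⟨(extChartAt I q).symm y, frame u y⟩ :
        TotalSpace E (TangentSpace I : M → Type _))) (extChartAt I q).target := by
    have htriv := (trivializationAt E (TangentSpace I : M → Type _) q).contMDiffOn_symm
      (IB := I) (n := ∞)
    refine (htriv.comp
      ((contMDiffOn_extChartAt_symm q).prodMk (contMDiffOn_const (c := u))) ?_).congr ?_
    · intro y hy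
      rw [mem_preimage, Trivialization.mem_target]
      exact extChartAt_symm_mem_baseSet hy
    · intro y hy
      dsimp only [frame]
      rw [Trivialization.symmL_apply _ (extChartAt_symm_mem_baseSet hy)]
      exact Trivialization.mk_symm _ (extChartAt_symm_mem_baseSet hy) u
  have hinner := ContMDiffOn.inner_bundle (E := fun x : M ↦ TangentSpace I x)
    (b := (extChartAt I q).symm) (v := frame u) (w := frame v) (hframe u) (hframe v)
  exact hinner.contDiffOn

theorem isMetricOn_chartMetric [FiniteDimensional ℝ E] [I.Boundaryless]
    [IsContMDiffRiemannianBundle I ∞ E (fun x : M ↦ TangentSpace I x)] (q : M) :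
    IsMetricOn (chartMetric I q) (extChartAt I q).target where
  isOpen := isOpen_extChartAt_target q
  contDiffOn := contDiffOn_clm_apply.2 fun u ↦ contDiffOn_clm_apply.2 fun v ↦
    (contDiffOn_chartMetric_apply q u v).of_le ENat.LEInfty.out
  symm y _ u v := chartMetric_symm q y u v
  isInvertible y hy := isInvertible_of_injective <| (injective_iff_map_eq_zero _).2 fun u hu ↦ by
    by_contra hne
    simpa [hu] using chartMetric_self_pos hy hne

theorem chartMetric_continuousLinearMapAt (hx : x ∈ (extChartAt I q).source)
    (v w : TangentSpace I x) :
    chartMetric I q (extChartAt I q x)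
      ((trivializationAt E (TangentSpace I : M → Type _) q).continuousLinearMapAt ℝ x v)
      ((trivializationAt E (TangentSpace I : M → Type _) q).continuousLinearMapAt ℝ x w)
      = inner ℝ v w := by
  have hbase : x ∈ (trivializationAt E (TangentSpace I : M → Type _) q).baseSet := by
    simpa using hx
  rw [chartMetric_apply, (extChartAt I q).left_inv hx,
    Trivialization.symmL_continuousLinearMapAt _ hbase,
    Trivialization.symmL_continuousLinearMapAt _ hbase]

theorem chartMetric_coordVector (q : M) (v w : TangentSpace I q) :
    chartMetric I q (extChartAt I q q) (coordVector I q v) (coordVector I q w) = inner ℝ v w :=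
  chartMetric_continuousLinearMapAt (mem_extChartAt_source q) v w

theorem norm_mfderiv_sq {V : Type*} [NormedAddCommGroup V] [NormedSpace ℝ V]
    {F : V → M} {v : V} (hF : MDifferentiableAt 𝓘(ℝ, V) I F v)
    (hx : F v ∈ (extChartAt I q).source) (w : V) :
    ‖mfderiv 𝓘(ℝ, V) I F v w‖ ^ 2 =
      pullback (chartMetric I q) (fun z ↦ extChartAt I q (F z)) v w w := by
  rw [pullback_apply, ← continuousLinearMapAt_mfderiv hF hx,
    chartMetric_continuousLinearMapAt hx, real_inner_self_eq_norm_sq]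

end ChartMetric

section GeodesicEquation

variable {E : Type*} [NormedAddCommGroup E] [NormedSpace ℝ E]

theorem eventuallyEq_nhdsGE_of_hasDerivAt {X : E → E} {u₁ u₂ : ℝ → E} {a : ℝ}
    (hX : ContDiffAt ℝ 1 X (u₁ a)) (h₁ : ∀ᶠ t in 𝓝[≥] a, HasDerivAt u₁ (X (u₁ t)) t)
    (h₂ : ∀ᶠ t in 𝓝[≥] a, HasDerivAt u₂ (X (u₂ t)) t) (heq : u₁ a = u₂ a) :
    u₁ =ᶠ[𝓝[≥] a] u₂ := by
  obtain ⟨K, S, hS, hK⟩ := hX.exists_lipschitzOnWith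
  have hS₁ : ∀ᶠ t in 𝓝[≥] a, u₁ t ∈ S :=
    (h₁.self_of_nhdsWithin self_mem_Ici).continuousAt.continuousWithinAt hS
  have hS₂ : ∀ᶠ t in 𝓝[≥] a, u₂ t ∈ S :=
    (h₂.self_of_nhdsWithin self_mem_Ici).continuousAt.continuousWithinAt (heq ▸ hS)
  obtain ⟨b, hab, hb⟩ := mem_nhdsGE_iff_exists_Icc_subset.1
    ((h₁.and hS₁).and (h₂.and hS₂))
  refine Filter.mem_of_superset (Icc_mem_nhdsGE hab) ?_
  exact ODE_solution_unique_of_mem_Icc_right (v := fun _ ↦ X) (s := fun _ ↦ S) (fun _ _ ↦ hK)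
    (fun t ht ↦ (hb ht).1.1.continuousAt.continuousWithinAt)
    (fun t ht ↦ (hb (Ico_subset_Icc_self ht)).1.1.hasDerivWithinAt)
    (fun t ht ↦ (hb (Ico_subset_Icc_self ht)).1.2)
    (fun t ht ↦ (hb ht).2.1.continuousAt.continuousWithinAt)
    (fun t ht ↦ (hb (Ico_subset_Icc_self ht)).2.1.hasDerivWithinAt)
    (fun t ht ↦ (hb (Ico_subset_Icc_self ht)).2.2) heq

/-- The geodesic equation `u'' + Γ(u', u') = 0` at the time `t`, for a curve `u` in coordinates
carrying the metric `g`. The curve is required to be smooth around `t`, so that the derivatives in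
the equation are not junk values. -/
structure IsGeodesicAt (g : E → E →L[ℝ] E →L[ℝ] ℝ) (u : ℝ → E) (t : ℝ) : Prop where
  contDiffAt : ContDiffAt ℝ 2 u t
  eq_zero : deriv (deriv u) t + christoffel g (u t) (deriv u t) (deriv u t) = 0

variable {g : E → E →L[ℝ] E →L[ℝ] ℝ} {U : Set E} {u u₁ u₂ : ℝ → E} {t : ℝ}

namespace IsGeodesicAt

theorem hasDerivAt (h : IsGeodesicAt g u t) : HasDerivAt u (deriv u t) t :=
  (h.contDiffAt.differentiableAt two_ne_zero).hasDerivAt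

theorem hasDerivAt_deriv (h : IsGeodesicAt g u t) :
    HasDerivAt (deriv u) (-christoffelCLM g (u t) (deriv u t) (deriv u t)) t := by
  have hderiv : ContDiffAt ℝ 1 (fun s ↦ fderiv ℝ u s 1) t :=
    (h.contDiffAt.fderiv_right (by norm_num)).clm_apply contDiffAt_const
  rw [christoffelCLM_apply, ← eq_neg_of_add_eq_zero_left h.eq_zero]
  exact (hderiv.differentiableAt one_ne_zero).hasDerivAt

theorem congr_of_eventuallyEq (h : IsGeodesicAt g u₁ t) (heq : u₁ =ᶠ[𝓝 t] u₂) :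
    IsGeodesicAt g u₂ t where
  contDiffAt := h.contDiffAt.congr_of_eventuallyEq heq.symm
  eq_zero := by
    rw [← heq.deriv.deriv_eq, ← heq.deriv_eq, ← heq.self_of_nhds]
    exact h.eq_zero

theorem hasDerivAt_speed (h : IsGeodesicAt g u t) (hg : IsMetricOn g U) (hU : u t ∈ U) :
    HasDerivAt (fun s ↦ g (u s) (deriv u s) (deriv u s)) 0 t := by
  have hgu : HasDerivAt (fun s ↦ g (u s)) (fderiv ℝ g (u t) (deriv u t)) t :=
    (hg.differentiableAt hU).hasFDerivAt.comp_hasDerivAt t h.hasDerivAt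
  refine ((hgu.clm_apply h.hasDerivAt_deriv).clm_apply h.hasDerivAt_deriv).congr_deriv ?_
  rw [add_apply, hg.fderiv_eq hU, map_neg, map_neg, neg_apply]
  ring

theorem eventuallyEq [CompleteSpace E] (hg : IsMetricOn g U)
    (h₁ : ∀ᶠ s in 𝓝[≥] t, IsGeodesicAt g u₁ s) (h₂ : ∀ᶠ s in 𝓝[≥] t, IsGeodesicAt g u₂ s)
    (hU : u₁ t ∈ U) (heq : u₁ t = u₂ t) (hderiv : deriv u₁ t = deriv u₂ t) :
    u₁ =ᶠ[𝓝[≥] t] u₂ := by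
  let spray (z : E × E) : E × E := (z.2, -christoffelCLM g z.1 z.2 z.2)
  have hspray : ContDiffAt ℝ 1 spray (u₁ t, deriv u₁ t) :=
    contDiffAt_snd.prodMk ((((hg.contDiffAt_christoffelCLM hU).comp (u₁ t, deriv u₁ t)
      contDiffAt_fst).clm_apply contDiffAt_snd).clm_apply contDiffAt_snd).neg
  have hphase := eventuallyEq_nhdsGE_of_hasDerivAt hspray
    (u₁ := fun s ↦ (u₁ s, deriv u₁ s)) (u₂ := fun s ↦ (u₂ s, deriv u₂ s))
    (h₁.mono fun s hs ↦ hs.hasDerivAt.prodMk hs.hasDerivAt_deriv)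
    (h₂.mono fun s hs ↦ hs.hasDerivAt.prodMk hs.hasDerivAt_deriv) (Prod.ext heq hderiv)
  exact hphase.mono fun s hs ↦ congrArg Prod.fst hs

end IsGeodesicAt

end GeodesicEquation

section Geodesic

variable {E : Type*} [NormedAddCommGroup E] [NormedSpace ℝ E]
  {H : Type*} [TopologicalSpace H] {I : ModelWithCorners ℝ E H}
  {M : Type*} [TopologicalSpace M] [ChartedSpace H M] [IsManifold I ∞ M]
  [RiemannianBundle (fun x : M ↦ TangentSpace I x)]
  {c c' : ℝ → M} {q x : M} {v : TangentSpace I q} {t τ : ℝ}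

namespace IsGeodesic

theorem contMDiffAt (hc : IsGeodesic I c) (ht : t ∈ Icc (0 : ℝ) 1) :
    ContMDiffAt 𝓘(ℝ, ℝ) I ∞ c t :=
  (hc t ht).1

theorem continuousOn (hc : IsGeodesic I c) : ContinuousOn c (Icc 0 1) :=
  fun _ ht ↦ (hc.contMDiffAt ht).continuousAt.continuousWithinAt

theorem isGeodesicAt (hc : IsGeodesic I c) (ht : t ∈ Icc (0 : ℝ) 1)
    (hx : c t ∈ (extChartAt I x).source) :
    IsGeodesicAt (chartMetric I x) (fun s ↦ extChartAt I x (c s)) t :=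
  ⟨(contDiffAt_extChartAt_comp (hc.contMDiffAt ht) hx).of_le ENat.LEInfty.out, (hc t ht).2 x hx⟩

theorem eventually_isGeodesicAt (hc : IsGeodesic I c) (ht : t ∈ Ico (0 : ℝ) 1)
    (hx : c t ∈ (extChartAt I x).source) :
    ∀ᶠ s in 𝓝[≥] t, c s ∈ (extChartAt I x).source ∧
      IsGeodesicAt (chartMetric I x) (fun s ↦ extChartAt I x (c s)) s := by
  have hsource := (hc.contMDiffAt (Ico_subset_Icc_self ht)).continuousAt.continuousWithinAt
    (s := Ici t) |>.eventually_mem ((isOpen_extChartAt_source x).mem_nhds hx)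
  filter_upwards [hsource, Icc_mem_nhdsGE_of_mem ht] with s hs hs'
  exact ⟨hs, hc.isGeodesicAt hs' hs⟩

theorem comp_mul (hc : IsGeodesic I c) (hτ : τ ∈ Icc (0 : ℝ) 1) :
    IsGeodesic I (fun s ↦ c (τ * s)) := by
  intro t ht
  have hτt : τ * t ∈ Icc (0 : ℝ) 1 := ⟨mul_nonneg hτ.1 ht.1, mul_le_one₀ hτ.2 ht.1 ht.2⟩
  refine ⟨(hc.contMDiffAt hτt).comp t (ContDiffAt.contMDiffAt (by fun_prop)), fun x hx ↦ ?_⟩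
  have hgeodesic := (hc.isGeodesicAt hτt hx).eq_zero
  have hderiv : deriv (fun s ↦ extChartAt I x (c (τ * s))) =
      fun s ↦ τ • deriv (fun s ↦ extChartAt I x (c s)) (τ * s) := by
    ext s
    exact deriv_comp_mul_left τ (fun s ↦ extChartAt I x (c s)) s
  simp only [hderiv]
  rw [deriv_fun_const_smul_field, deriv_comp_mul_left τ (deriv fun s ↦ extChartAt I x (c s))]
  simp only [← christoffelCLM_apply, map_smul, smul_apply, ← smul_add] at hgeodesic ⊢
  rw [hgeodesic, smul_zero, smul_zero]

variable [FiniteDimensional ℝ E] [I.Boundaryless]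
  [IsContMDiffRiemannianBundle I ∞ E (fun x : M ↦ TangentSpace I x)]

theorem hasDerivAt_norm_mfderiv_sq (hc : IsGeodesic I c) (ht : t ∈ Icc (0 : ℝ) 1) :
    HasDerivAt (fun s ↦ ‖mfderiv 𝓘(ℝ, ℝ) I c s (1 : ℝ)‖ ^ 2) 0 t := by
  have hx := mem_extChartAt_source (I := I) (c t)
  have hspeed := (hc.isGeodesicAt ht hx).hasDerivAt_speed (isMetricOn_chartMetric (c t))
    ((extChartAt I (c t)).map_source hx)
  refine hspeed.congr_of_eventuallyEq ?_
  have hsmooth : ∀ᶠ s in 𝓝 t, ContMDiffAt 𝓘(ℝ, ℝ) I 1 c s :=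
    (contMDiffAt_iff_contMDiffAt_nhds (by simp)).1
      ((hc.contMDiffAt ht).of_le ENat.LEInfty.out)
  filter_upwards [hsmooth, (hc.contMDiffAt ht).continuousAt.eventually_mem
    ((isOpen_extChartAt_source (c t)).mem_nhds hx)] with s hs hs'
  exact norm_mfderiv_sq (hs.mdifferentiableAt one_ne_zero) hs' 1

theorem norm_mfderiv_eq (hc : IsGeodesic I c) (ht : t ∈ Icc (0 : ℝ) 1) :
    ‖mfderiv 𝓘(ℝ, ℝ) I c t (1 : ℝ)‖ = ‖mfderiv 𝓘(ℝ, ℝ) I c 0 (1 : ℝ)‖ :=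
  (sq_eq_sq₀ (norm_nonneg _) (norm_nonneg _)).1 <| constant_of_has_deriv_right_zero
    (fun _ hs ↦ (hc.hasDerivAt_norm_mfderiv_sq hs).continuousAt.continuousWithinAt)
    (fun _ hs ↦ (hc.hasDerivAt_norm_mfderiv_sq (Ico_subset_Icc_self hs)).hasDerivWithinAt) t ht

end IsGeodesic

namespace IsGeodesicFrom

theorem mem_source (hc : IsGeodesicFrom I q v c) : c 0 ∈ (extChartAt I q).source := by
  rw [hc.2.1]
  exact mem_extChartAt_source q

theorem comp_mul (hc : IsGeodesicFrom I q v c) (hτ : τ ∈ Icc (0 : ℝ) 1) :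
    IsGeodesicFrom I q (τ • v) (fun s ↦ c (τ * s)) := by
  refine ⟨hc.1.comp_mul hτ, by simpa using hc.2.1, ?_⟩
  rw [deriv_comp_mul_left τ (fun s ↦ extChartAt I q (c s)), coordVector_smul, mul_zero, hc.2.2]

theorem deriv_extChartAt_eq (hc : IsGeodesicFrom I q v c) (hc' : IsGeodesicFrom I q v c')
    (ht : t ∈ Icc (0 : ℝ) 1) (heq : EqOn c c' (Icc 0 t)) :
    deriv (fun s ↦ extChartAt I (c t) (c s)) t = deriv (fun s ↦ extChartAt I (c t) (c' s)) t := by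
  rcases ht.1.eq_or_lt with rfl | ht₀
  · rw [hc.2.1, hc.2.2, hc'.2.2]
  have heq_t : c t = c' t := heq (right_mem_Icc.2 ht.1)
  have hx := mem_extChartAt_source (I := I) (c t)
  have hderiv := (hc.1.isGeodesicAt ht hx).hasDerivAt.hasDerivWithinAt (s := Iic t)
  have hderiv' := (hc'.1.isGeodesicAt (x := c t) ht (heq_t ▸ hx)).hasDerivAt.hasDerivWithinAt
    (s := Iic t)
  refine (uniqueDiffWithinAt_Iic t).eq_deriv _ hderiv
    (hderiv'.congr_of_eventuallyEq ?_ (congrArg (extChartAt I (c t)) heq_t))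
  filter_upwards [Ioc_mem_nhdsLE ht₀] with s hs
  exact congrArg (extChartAt I (c t)) (heq ⟨hs.1.le, hs.2⟩)

variable [FiniteDimensional ℝ E] [I.Boundaryless]
  [IsContMDiffRiemannianBundle I ∞ E (fun x : M ↦ TangentSpace I x)]

theorem norm_mfderiv_eq (hc : IsGeodesicFrom I q v c) (ht : t ∈ Icc (0 : ℝ) 1) :
    ‖mfderiv 𝓘(ℝ, ℝ) I c t (1 : ℝ)‖ = ‖v‖ := by
  refine (hc.1.norm_mfderiv_eq ht).trans ((sq_eq_sq₀ (norm_nonneg _) (norm_nonneg _)).1 ?_)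
  rw [norm_mfderiv_sq ((hc.1.contMDiffAt (by simp)).mdifferentiableAt (by simp)) hc.mem_source 1,
    pullback_apply, fderiv_apply_one_eq_deriv, hc.2.2, hc.2.1, chartMetric_coordVector,
    real_inner_self_eq_norm_sq]

variable [T2Space M]

theorem eqOn (hc : IsGeodesicFrom I q v c) (hc' : IsGeodesicFrom I q v c') :
    EqOn c c' (Icc 0 1) := by
  have hclosed : IsClosed ({t | c t = c' t} ∩ Icc (0 : ℝ) 1) := by
    rw [inter_comm]
    exact (hc.1.continuousOn.prodMk hc'.1.continuousOn).preimage_isClosed_of_isClosed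
      isClosed_Icc isClosed_diagonal
  refine hclosed.Icc_subset_of_forall_mem_nhdsGT_of_Icc_subset
    (by rw [mem_ofPred_eq, hc.2.1, hc'.2.1]) fun t ht heq ↦ ?_
  have hx := mem_extChartAt_source (I := I) (c t)
  have heq_t : c t = c' t := heq (right_mem_Icc.2 ht.1)
  have hgeodesic := hc.1.eventually_isGeodesicAt ht hx
  have hgeodesic' := hc'.1.eventually_isGeodesicAt (x := c t) ht (heq_t ▸ hx)
  have hcoord := IsGeodesicAt.eventuallyEq (isMetricOn_chartMetric (c t))
    (hgeodesic.mono fun _ hs ↦ hs.2) (hgeodesic'.mono fun _ hs ↦ hs.2)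
    ((extChartAt I (c t)).map_source hx) (congrArg (extChartAt I (c t)) heq_t)
    (hc.deriv_extChartAt_eq hc' (Ico_subset_Icc_self ht) heq)
  refine Filter.Eventually.filter_mono (nhdsWithin_mono t Ioi_subset_Ici_self) ?_
  filter_upwards [hcoord, hgeodesic, hgeodesic'] with s hs hs₁ hs₂
  exact (extChartAt I (c t)).injOn hs₁.1 hs₂.1 hs

theorem exp_smul (hc : IsGeodesicFrom I q v c) (hτ : τ ∈ Icc (0 : ℝ) 1) :
    Exp I q (τ • v) = c τ := by
  have hexists : ∃ c, IsGeodesicFrom I q (τ • v) c := ⟨_, hc.comp_mul hτ⟩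
  rw [Exp, dif_pos hexists]
  simpa using hexists.choose_spec.eqOn (hc.comp_mul hτ) (right_mem_Icc.2 zero_le_one)

end IsGeodesicFrom

end Geodesic

theorem exists_isLittleO_forall_le {α ι F : Type*} [NormedAddCommGroup F] {l : Filter α}
    {s : Set α} {f : α → ι → ℝ} {g : α → F} (hbdd : ∀ a ∈ s, BddAbove (range (f a)))
    (hf : ∀ ε > 0, ∀ᶠ a in l, ∀ i, f a i ≤ ε * ‖g a‖) :
    ∃ η : α → ℝ, η =o[l] g ∧ ∀ a ∈ s, ∀ i, f a i ≤ η a := by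
  refine ⟨fun a ↦ ⨆ i, max (f a i) 0, Asymptotics.isLittleO_iff.2 fun ε hε ↦ ?_, fun a ha i ↦ ?_⟩
  · filter_upwards [hf ε hε] with a ha
    rw [Real.norm_of_nonneg (Real.iSup_nonneg fun i ↦ le_max_right _ _)]
    exact Real.iSup_le (fun i ↦ max_le (ha i) (by positivity)) (by positivity)
  · obtain ⟨B, hB⟩ := hbdd a ha
    have hmax : BddAbove (range fun i ↦ max (f a i) 0) :=
      ⟨max B 0, forall_mem_range.2 fun i ↦ max_le_max_right 0 (hB (mem_range_self i))⟩
    exact (le_max_left _ _).trans (le_ciSup hmax i)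

section Exp

variable {E : Type*} [NormedAddCommGroup E] [NormedSpace ℝ E]
  {H : Type*} [TopologicalSpace H] {I : ModelWithCorners ℝ E H}
  {M : Type*} [TopologicalSpace M] [ChartedSpace H M] [IsManifold I ∞ M]
  [RiemannianBundle (fun x : M ↦ TangentSpace I x)] {q : M} {v : TangentSpace I q}

theorem IsGeodesicAt.hessian_self {V : Type*} [NormedAddCommGroup V] [NormedSpace ℝ V]
    {g : E → E →L[ℝ] E →L[ℝ] ℝ} {f : V → E} {v : V} {t : ℝ}
    (h : IsGeodesicAt g (fun s ↦ f (s • v)) t) (hf : ContDiffAt ℝ 2 f (t • v)) :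
    hessian g f (t • v) v v = 0 := by
  have hderiv : deriv (fun s ↦ f (s • v)) =ᶠ[𝓝 t] fun s ↦ fderiv ℝ f (s • v) v := by
    have hline : ContinuousAt (fun s : ℝ ↦ s • v) t := by fun_prop
    filter_upwards [hline.eventually (hf.eventually (by simp))] with s hs
    exact (hasDerivAt_comp_smul (hs.differentiableAt two_ne_zero)).deriv
  have hf' : DifferentiableAt ℝ (fderiv ℝ f) (t • v) :=
    (hf.fderiv_right (m := 1) (by norm_num)).differentiableAt one_ne_zero
  have hderiv₂ : deriv (deriv fun s ↦ f (s • v)) t = fderiv ℝ (fderiv ℝ f) (t • v) v v := by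
    rw [hderiv.deriv_eq, (hasDerivAt_comp_smul (f := fun z ↦ fderiv ℝ f z v) (by fun_prop)).deriv,
      fderiv_clm_apply_const hf']
  have hgeodesic := h.eq_zero
  rwa [hderiv₂, hderiv.self_of_nhds, ← christoffelCLM_apply, ← hessian_apply] at hgeodesic

theorem exists_isDiffeoOnBall (hv : ‖v‖ₑ < injectivityRadius I q) :
    ∃ a : ℝ≥0, IsDiffeoOnBall I q a ∧ v ∈ Metric.ball (0 : TangentSpace I q) a := by
  simp only [injectivityRadius, lt_iSup_iff] at hv
  obtain ⟨a, ha, hlt⟩ := hv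
  refine ⟨a, ha, ?_⟩
  rw [mem_ball_zero_iff, ← coe_nnnorm]
  exact_mod_cast hlt

theorem exists_isGeodesicFrom (hv : ‖v‖ₑ < injectivityRadius I q) :
    ∃ c, IsGeodesicFrom I q v c := by
  obtain ⟨a, ha, hva⟩ := exists_isDiffeoOnBall hv
  exact ha.1 hva

theorem contMDiffAt_exp (hv : ‖v‖ₑ < injectivityRadius I q) :
    ContMDiffAt 𝓘(ℝ, TangentSpace I q) I ∞ (Exp I q) v := by
  obtain ⟨a, ⟨_, Φ, hsource, heq, hΦ, _⟩, hva⟩ := exists_isDiffeoOnBall hv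
  rw [hsource] at heq hΦ
  exact (hΦ.congr fun x hx ↦ (heq hx).symm).contMDiffAt (Metric.isOpen_ball.mem_nhds hva)

theorem exists_pos_isGeodesicFrom_smul (hr : 0 < injectivityRadius I q) (v : TangentSpace I q) :
    ∃ l : ℝ, 0 < l ∧ ∃ c, IsGeodesicFrom I q (l • v) c := by
  have hcont : Continuous fun l : ℝ ↦ ‖l • v‖ₑ := by fun_prop
  have hsmall : ∀ᶠ l : ℝ in 𝓝[>] 0, ‖l • v‖ₑ < injectivityRadius I q :=
    (hcont.continuousAt.eventually_lt_const (by simpa using hr)).filter_mono nhdsWithin_le_nhds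
  obtain ⟨l, hlv, hl⟩ := (hsmall.and self_mem_nhdsWithin).exists
  exact ⟨l, hl, exists_isGeodesicFrom hlv⟩

variable [FiniteDimensional ℝ E] [I.Boundaryless] [T2Space M]
  [IsContMDiffRiemannianBundle I ∞ E (fun x : M ↦ TangentSpace I x)]

theorem exp_zero (hr : 0 < injectivityRadius I q) : Exp I q (0 : TangentSpace I q) = q := by
  obtain ⟨c, hc⟩ := exists_isGeodesicFrom (I := I) (q := q) (v := 0) (by simpa using hr)
  simpa [hc.2.1] using hc.exp_smul (τ := 0) (by simp)

theorem eventually_exp_mem_source (hr : 0 < injectivityRadius I q) :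
    ∀ᶠ v : TangentSpace I q in 𝓝 0, Exp I q v ∈ (extChartAt I q).source :=
  (contMDiffAt_exp (by simpa using hr)).continuousAt.eventually_mem
    (by rw [exp_zero hr]; exact extChartAt_source_mem_nhds q)

theorem contDiffAt_extChartAt_exp (hr : 0 < injectivityRadius I q) :
    ContDiffAt ℝ ∞ (fun v ↦ extChartAt I q (Exp I q v)) 0 :=
  contDiffAt_extChartAt_comp (contMDiffAt_exp (by simpa using hr))
    (eventually_exp_mem_source hr).self_of_nhds

theorem eventually_hessian_extChartAt_exp_self (hr : 0 < injectivityRadius I q)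
    (v : TangentSpace I q) :
    ∀ᶠ t : ℝ in 𝓝[>] 0,
      hessian (chartMetric I q) (fun w ↦ extChartAt I q (Exp I q w)) (t • v) v v = 0 := by
  obtain ⟨l, hl, c, hc⟩ := exists_pos_isGeodesicFrom_smul hr v
  have hscale : Filter.Tendsto (fun t : ℝ ↦ t / l) (𝓝[>] 0) (𝓝[>] 0) := by
    have hdiv := (continuous_id.div_const l).continuousWithinAt.tendsto_nhdsWithin
      (x := (0 : ℝ)) (s := Ioi 0) (t := Ioi 0) fun t ht ↦ div_pos ht hl
    simpa using hdiv
  have hline : ContinuousAt (fun t : ℝ ↦ t • v) 0 := by fun_prop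
  filter_upwards [hscale.eventually (Ioo_mem_nhdsGT zero_lt_one),
    hscale.eventually ((hc.1.eventually_isGeodesicAt (by simp) hc.mem_source).filter_mono
      (nhdsWithin_mono 0 Ioi_subset_Ici_self)),
    (hline.eventually (by simpa using
      ((contDiffAt_extChartAt_exp hr).of_le ENat.LEInfty.out).eventually (n := 2) (by simp))
      ).filter_mono nhdsWithin_le_nhds] with t ht hgeodesic hsmooth
  have heq : (fun s ↦ extChartAt I q (c s)) =ᶠ[𝓝 (t / l)]
      fun s ↦ extChartAt I q (Exp I q (s • l • v)) := by
    filter_upwards [Ioo_mem_nhds ht.1 ht.2] with s hs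
    rw [hc.exp_smul ⟨hs.1.le, hs.2.le⟩]
  have htv : (t / l) • l • v = t • v := by rw [smul_smul, div_mul_cancel₀ _ hl.ne']
  have hself := (hgeodesic.2.congr_of_eventuallyEq heq).hessian_self (by rwa [htv])
  simpa [htv, hl.ne'] using hself

theorem isNormalMap_extChartAt_exp (hr : 0 < injectivityRadius I q) :
    IsNormalMap (chartMetric I q) (extChartAt I q).target
      (fun v : TangentSpace I q ↦ extChartAt I q (Exp I q v)) where
  metric := isMetricOn_chartMetric q
  zero_mem := (extChartAt I q).map_source (eventually_exp_mem_source hr).self_of_nhds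
  contDiffAt := (contDiffAt_extChartAt_exp hr).of_le ENat.LEInfty.out
  hessian_self := eventually_hessian_extChartAt_exp_self hr

theorem fderiv_extChartAt_exp_zero (hr : 0 < injectivityRadius I q) (v : TangentSpace I q) :
    fderiv ℝ (fun w ↦ extChartAt I q (Exp I q w)) 0 v = coordVector I q v := by
  obtain ⟨l, hl, c, hc⟩ := exists_pos_isGeodesicFrom_smul hr v
  have hexp := (hasDerivAt_comp_smul (f := fun w ↦ extChartAt I q (Exp I q w)) (t := (0 : ℝ))
    (v := l • v) (by
      rw [zero_smul]
      exact (contDiffAt_extChartAt_exp hr).differentiableAt (by simp))).hasDerivWithinAt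
    (s := Ici 0)
  have hgeodesic := (hc.1.isGeodesicAt (by simp) hc.mem_source).hasDerivAt.hasDerivWithinAt
    (s := Ici 0)
  have heq : (fun s : ℝ ↦ extChartAt I q (Exp I q (s • l • v))) =ᶠ[𝓝[≥] 0]
      fun s ↦ extChartAt I q (c s) := by
    filter_upwards [Ico_mem_nhdsGE zero_lt_one] with s hs
    rw [hc.exp_smul ⟨hs.1, hs.2.le⟩]
  have hderiv := (uniqueDiffWithinAt_Ici (0 : ℝ)).eq_deriv _ hexp
    (hgeodesic.congr_of_eventuallyEq heq (heq.self_of_nhdsWithin self_mem_Ici))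
  rw [hc.2.2, zero_smul, map_smul, coordVector_smul] at hderiv
  exact smul_right_injective E hl.ne' hderiv

end Exp

section Curvature

variable {E : Type*} [NormedAddCommGroup E] [NormedSpace ℝ E]
  {H : Type*} [TopologicalSpace H] {I : ModelWithCorners ℝ E H}
  {M : Type*} [TopologicalSpace M] [ChartedSpace H M] [IsManifold I ∞ M]
  [RiemannianBundle (fun x : M ↦ TangentSpace I x)] {q : M}

variable (I q) in
/-- The curvature form `⟨R(v, w)w, v⟩` of two tangent vectors at `q`, computed in the preferred
chart at `q`. It is the numerator of the sectional curvature of the plane that they span. -/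
def curvatureForm (v w : TangentSpace I q) : ℝ :=
  coordCurvatureForm (chartMetric I q) (extChartAt I q q) (coordVector I q v) (coordVector I q w)

variable [FiniteDimensional ℝ E] [I.Boundaryless]
  [IsContMDiffRiemannianBundle I ∞ E (fun x : M ↦ TangentSpace I x)]

theorem curvatureForm_basis_change (v w : TangentSpace I q) (a b c d : ℝ) :
    curvatureForm I q (a • v + b • w) (c • v + d • w) =
      (a * d - b * c) ^ 2 * curvatureForm I q v w := by
  simp only [curvatureForm, coordVector_add, coordVector_smul,
    (isMetricOn_chartMetric q).coordCurvatureForm_basis_change (mem_extChartAt_target q)]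

theorem curvatureForm_smul_right (v w : TangentSpace I q) (a : ℝ) :
    curvatureForm I q v (a • w) = a ^ 2 * curvatureForm I q v w := by
  simpa using curvatureForm_basis_change v w 1 0 0 a

theorem continuous_curvatureForm (q : M) :
    Continuous fun p : TangentSpace I q × TangentSpace I q ↦ curvatureForm I q p.1 p.2 := by
  have hfst : Continuous fun p : TangentSpace I q × TangentSpace I q ↦ coordVector I q p.1 :=
    (continuous_coordVector q).comp continuous_fst
  have hsnd : Continuous fun p : TangentSpace I q × TangentSpace I q ↦ coordVector I q p.2 :=
    (continuous_coordVector q).comp continuous_snd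
  simp only [curvatureForm, coordCurvatureForm,
    (isMetricOn_chartMetric q).curvature_eq (mem_extChartAt_target q)]
  generalize fderiv ℝ (christoffelCLM (chartMetric I q)) (extChartAt I q q) = dΓ
  fun_prop

theorem continuousAt_norm_mfderiv {V : Type*} [NormedAddCommGroup V] [NormedSpace ℝ V]
    {F : V → M} {v : V} (hF : ContMDiffAt 𝓘(ℝ, V) I ∞ F v) (w : V) :
    ContinuousAt (fun p : V × V ↦ ‖mfderiv 𝓘(ℝ, V) I F p.1 p.2‖) (v, w) := by
  have hx := mem_extChartAt_source (I := I) (F v)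
  have hpullback : ContinuousAt (pullback (chartMetric I (F v)) fun z ↦ extChartAt I (F v) (F z))
      v :=
    ((isMetricOn_chartMetric (F v)).contDiffAt_pullback (f := fun z ↦ extChartAt I (F v) (F z))
      ((extChartAt I (F v)).map_source hx)
      ((contDiffAt_extChartAt_comp hF hx).of_le ENat.LEInfty.out)).continuousAt
  have hfst : ContinuousAt (fun p : V × V ↦ pullback (chartMetric I (F v))
      (fun z ↦ extChartAt I (F v) (F z)) p.1) (v, w) :=
    ContinuousAt.comp (f := Prod.fst) (x := (v, w)) hpullback continuousAt_fst
  refine (Real.continuous_sqrt.continuousAt.comp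
    ((hfst.clm_apply continuousAt_snd).clm_apply continuousAt_snd)).congr ?_
  have hsmooth : ∀ᶠ z in 𝓝 v, ContMDiffAt 𝓘(ℝ, V) I 1 F z :=
    (contMDiffAt_iff_contMDiffAt_nhds (by simp)).1 (hF.of_le ENat.LEInfty.out)
  have hsource : ∀ᶠ z in 𝓝 v, F z ∈ (extChartAt I (F v)).source :=
    hF.continuousAt.eventually_mem ((isOpen_extChartAt_source _).mem_nhds hx)
  filter_upwards [continuousAt_fst.eventually (hsmooth.and hsource)] with p hp
  rw [Function.comp_apply, ← norm_mfderiv_sq (hp.1.mdifferentiableAt one_ne_zero) hp.2,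
    Real.sqrt_sq (norm_nonneg _)]

theorem bddAbove_norm_mfderiv_exp_sub {δ : ℝ} (hδ : 0 ≤ δ)
    (hr : ENNReal.ofReal δ < injectivityRadius I q) :
    BddAbove ((fun p : TangentSpace I q × TangentSpace I q ↦
      ‖mfderiv 𝓘(ℝ, TangentSpace I q) I (Exp I q) (δ • p.1) p.2‖
        - (1 - curvatureForm I q p.2 p.1 / 6 * δ ^ 2)) ''
      Metric.sphere 0 1 ×ˢ Metric.sphere 0 1) := by
  have : FiniteDimensional ℝ (TangentSpace I q) := inferInstanceAs (FiniteDimensional ℝ E)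
  have : ProperSpace (TangentSpace I q) := FiniteDimensional.proper_real _
  refine ((isCompact_sphere _ _).prod (isCompact_sphere _ _)).bddAbove_image fun p hp ↦ ?_
  have hnorm : ‖δ • p.1‖ₑ < injectivityRadius I q := by
    rwa [← ofReal_norm, norm_smul, mem_sphere_zero_iff_norm.1 hp.1, mul_one,
      Real.norm_of_nonneg hδ]
  have hscale : Continuous fun p : TangentSpace I q × TangentSpace I q ↦ (δ • p.1, p.2) := by
    fun_prop
  have hexp := ContinuousAt.comp (f := fun p : TangentSpace I q × TangentSpace I q ↦
    (δ • p.1, p.2)) (x := p) (continuousAt_norm_mfderiv (contMDiffAt_exp hnorm) p.2)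
    hscale.continuousAt
  have hcurvature := (continuous_curvatureForm (I := I) q).comp continuous_swap
  exact (hexp.sub (continuous_const.sub
    ((hcurvature.div_const 6).mul_const (δ ^ 2))).continuousAt).continuousWithinAt

variable [T2Space M]

theorem norm_mfderiv_exp_expansion (hr : 0 < injectivityRadius I q) {ε : ℝ} (hε : 0 < ε) :
    ∀ᶠ v : TangentSpace I q in 𝓝 0, ∀ w : TangentSpace I q,
      |‖mfderiv 𝓘(ℝ, TangentSpace I q) I (Exp I q) v w‖ ^ 2 - ‖w‖ ^ 2
        + 1 / 3 * curvatureForm I q w v| ≤ ε * ‖v‖ ^ 2 * ‖w‖ ^ 2 := by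
  have hsmall : ∀ᶠ v : TangentSpace I q in 𝓝 0, ‖v‖ₑ < injectivityRadius I q :=
    continuous_enorm.continuousAt.eventually_lt_const (by simpa using hr)
  filter_upwards [(isNormalMap_extChartAt_exp hr).pullback_expansion hε, hsmall,
    eventually_exp_mem_source hr] with v hexpansion hv hsource w
  have hw := hexpansion w
  rwa [← norm_mfderiv_sq ((contMDiffAt_exp hv).mdifferentiableAt (by simp)) hsource,
    pullback_apply, fderiv_extChartAt_exp_zero hr, fderiv_extChartAt_exp_zero hr, exp_zero hr,
    chartMetric_coordVector, real_inner_self_eq_norm_sq] at hw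

theorem eventually_norm_mfderiv_exp_le (hr : 0 < injectivityRadius I q) {ε : ℝ} (hε : 0 < ε) :
    ∀ᶠ δ : ℝ in 𝓝 0, ∀ e n : TangentSpace I q, ‖e‖ = 1 → ‖n‖ = 1 →
      ‖mfderiv 𝓘(ℝ, TangentSpace I q) I (Exp I q) (δ • e) n‖
        ≤ 1 - curvatureForm I q n e / 6 * δ ^ 2 + ε * δ ^ 2 := by
  obtain ⟨ρ, hρ, hball⟩ := Metric.eventually_nhds_iff_ball.1
    (norm_mfderiv_exp_expansion hr (ε := 2 * ε) (by positivity))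
  filter_upwards [Metric.ball_mem_nhds 0 hρ] with δ hδ e n he hn
  have hnorm : ‖δ • e‖ = |δ| := by rw [norm_smul, he, mul_one, Real.norm_eq_abs]
  have hexpansion := (abs_le.1 (hball (δ • e) (by simpa [hnorm] using hδ) n)).2
  rw [hnorm, hn, sq_abs, curvatureForm_smul_right] at hexpansion
  -- `x ≤ (x ^ 2 + 1) / 2`
  nlinarith [sq_nonneg (‖mfderiv 𝓘(ℝ, TangentSpace I q) I (Exp I q) (δ • e) n‖ - 1)]

theorem exists_norm_mfderiv_exp_le (q : M) :
    ∃ η : ℝ → ℝ, η =o[𝓝[>] 0] (fun δ : ℝ ↦ δ ^ 2) ∧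
      ∀ δ, 0 ≤ δ → ENNReal.ofReal δ < injectivityRadius I q →
        ∀ e n : TangentSpace I q, ‖e‖ = 1 → ‖n‖ = 1 →
          ‖mfderiv 𝓘(ℝ, TangentSpace I q) I (Exp I q) (δ • e) n‖
            ≤ 1 - curvatureForm I q n e / 6 * δ ^ 2 + η δ := by
  rcases (zero_le (a := injectivityRadius I q)).eq_or_lt with hr | hr
  · refine ⟨0, Asymptotics.isLittleO_zero _ _, fun δ _ hδ ↦ ?_⟩
    exact absurd (hr ▸ hδ) not_lt_zero
  let S : Set (TangentSpace I q × TangentSpace I q) := Metric.sphere 0 1 ×ˢ Metric.sphere 0 1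
  obtain ⟨η, hη, hle⟩ := exists_isLittleO_forall_le (l := 𝓝[>] 0) (g := fun δ : ℝ ↦ δ ^ 2)
    (s := {δ : ℝ | 0 ≤ δ ∧ ENNReal.ofReal δ < injectivityRadius I q})
    (f := fun δ (p : S) ↦ ‖mfderiv 𝓘(ℝ, TangentSpace I q) I (Exp I q) (δ • p.1.1) p.1.2‖
        - (1 - curvatureForm I q p.1.2 p.1.1 / 6 * δ ^ 2))
    (fun δ hδ ↦ by
      rw [← image_eq_range (fun p : TangentSpace I q × TangentSpace I q ↦
        ‖mfderiv 𝓘(ℝ, TangentSpace I q) I (Exp I q) (δ • p.1) p.2‖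
          - (1 - curvatureForm I q p.2 p.1 / 6 * δ ^ 2)) S]
      exact bddAbove_norm_mfderiv_exp_sub hδ.1 hδ.2)
    (fun ε hε ↦ by
      filter_upwards [(eventually_norm_mfderiv_exp_le hr hε).filter_mono nhdsWithin_le_nhds]
        with δ hδ p
      rw [Real.norm_of_nonneg (sq_nonneg δ)]
      exact sub_le_iff_le_add'.2 (hδ _ _ (mem_sphere_zero_iff_norm.1 p.2.1)
        (mem_sphere_zero_iff_norm.1 p.2.2)))
  exact ⟨η, hη, fun δ hδ hr' e n he hn ↦ sub_le_iff_le_add'.1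
    (hle δ ⟨hδ, hr'⟩ ⟨(e, n), mem_sphere_zero_iff_norm.2 he, mem_sphere_zero_iff_norm.2 hn⟩)⟩

end Curvature

section Plane

variable {V : Type*} [NormedAddCommGroup V] [InnerProductSpace ℝ V] {x y e n : V}

theorem inner_smul_add_smul (he : ‖e‖ = 1) (hn : ‖n‖ = 1) (hen : inner ℝ e n = 0) (a b c d : ℝ) :
    inner ℝ (a • e + b • n) (c • e + d • n) = a * c + b * d := by
  simp only [inner_add_left, inner_add_right, real_inner_smul_left, real_inner_smul_right,
    real_inner_self_eq_norm_sq, he, hn, hen, real_inner_comm e n]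
  ring

theorem norm_smul_add_smul_eq_one (he : ‖e‖ = 1) (hn : ‖n‖ = 1) (hen : inner ℝ e n = 0) {a b : ℝ}
    (hab : a ^ 2 + b ^ 2 = 1) : ‖a • e + b • n‖ = 1 := by
  rw [norm_eq_sqrt_real_inner, inner_smul_add_smul he hn hen, ← sq, ← sq, hab, Real.sqrt_one]

open InnerProductGeometry in
theorem sin_angle_pos_of_linearIndependent (h : LinearIndependent ℝ ![x, y]) :
    0 < Real.sin (angle x y) := by
  have hsmul := (LinearIndependent.pair_iff' (h.ne_zero 0)).1 h
  refine (sin_angle_nonneg x y).lt_of_ne' fun hsin ↦ ?_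
  rcases sin_eq_zero_iff_angle_eq_zero_or_angle_eq_pi.1 hsin with hzero | hpi
  · obtain ⟨_, r, _, hr⟩ := angle_eq_zero_iff.1 hzero
    exact hsmul r hr.symm
  · obtain ⟨_, r, _, hr⟩ := angle_eq_pi_iff.1 hpi
    exact hsmul r hr.symm

open InnerProductGeometry in
theorem exists_orthonormal_of_linearIndependent (h : LinearIndependent ℝ ![x, y]) :
    ∃ e n : V, ‖e‖ = 1 ∧ ‖n‖ = 1 ∧ inner ℝ e n = 0 ∧ x = ‖x‖ • e ∧
      y = ‖y‖ • (Real.cos (angle x y) • e + Real.sin (angle x y) • n) := by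
  have hx : ‖x‖ ≠ 0 := norm_ne_zero_iff.2 (h.ne_zero 0)
  have hy : ‖y‖ ≠ 0 := norm_ne_zero_iff.2 (h.ne_zero 1)
  have hsin := (sin_angle_pos_of_linearIndependent h).ne'
  obtain ⟨e, he, hxe⟩ : ∃ e : V, ‖e‖ = 1 ∧ x = ‖x‖ • e :=
    ⟨‖x‖⁻¹ • x, norm_smul_inv_norm (𝕜 := ℝ) (h.ne_zero 0), (smul_inv_smul₀ hx x).symm⟩
  obtain ⟨f, hf, hyf⟩ : ∃ f : V, ‖f‖ = 1 ∧ y = ‖y‖ • f :=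
    ⟨‖y‖⁻¹ • y, norm_smul_inv_norm (𝕜 := ℝ) (h.ne_zero 1), (smul_inv_smul₀ hy y).symm⟩
  have hef : inner ℝ e f = Real.cos (angle x y) := by
    rw [hxe, hyf, angle_smul_left_of_pos _ _ (by positivity),
      angle_smul_right_of_pos _ _ (by positivity), cos_angle, he, hf, mul_one, div_one]
  have hnorm : ‖f - Real.cos (angle x y) • e‖ = Real.sin (angle x y) := by
    refine (sq_eq_sq₀ (norm_nonneg _) (sin_angle_nonneg x y)).1 ?_
    rw [norm_sub_sq_real, real_inner_smul_right, real_inner_comm, hef, norm_smul, he, hf,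
      mul_one, Real.norm_eq_abs, sq_abs, Real.sin_sq]
    ring
  refine ⟨e, (Real.sin (angle x y))⁻¹ • (f - Real.cos (angle x y) • e), he, ?_, ?_, hxe, ?_⟩
  · rw [norm_smul, norm_inv, hnorm, Real.norm_of_nonneg (sin_angle_nonneg x y),
      inv_mul_cancel₀ hsin]
  · rw [real_inner_smul_right, inner_sub_right, real_inner_smul_right, hef,
      real_inner_self_eq_norm_sq, he]
    ring
  · rwa [smul_inv_smul₀ hsin, add_sub_cancel]

end Plane

section SectionalCurvature

variable {E : Type*} [NormedAddCommGroup E] [NormedSpace ℝ E] [FiniteDimensional ℝ E]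
  {H : Type*} [TopologicalSpace H] {I : ModelWithCorners ℝ E H} [I.Boundaryless]
  {M : Type*} [TopologicalSpace M] [ChartedSpace H M] [IsManifold I ∞ M]
  [RiemannianBundle (fun x : M ↦ TangentSpace I x)]
  [IsContMDiffRiemannianBundle I ∞ E (fun x : M ↦ TangentSpace I x)] {q : M}

theorem curvatureForm_rotate (e n : TangentSpace I q) (s : ℝ) :
    curvatureForm I q (-Real.sin s • e + Real.cos s • n) (Real.cos s • e + Real.sin s • n) =
      curvatureForm I q e n := by
  have hdet : -Real.sin s * Real.sin s - Real.cos s * Real.cos s = -1 := by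
    linear_combination -Real.sin_sq_add_cos_sq s
  rw [curvatureForm_basis_change, hdet, neg_one_sq, one_mul]

theorem sectionalCurvature_eq {e n : TangentSpace I q} (he : ‖e‖ = 1) (hn : ‖n‖ = 1)
    (hen : inner ℝ e n = 0) {a b c d : ℝ} (hdet : a * d - b * c ≠ 0) :
    sectionalCurvature I q (a • e + b • n) (c • e + d • n) = curvatureForm I q e n := by
  have hgram : (a * a + b * b) * (c * c + d * d) - (a * c + b * d) ^ 2 = (a * d - b * c) ^ 2 := by
    ring
  have hcurvature := curvatureForm_basis_change e n a b c d
  rw [curvatureForm, coordCurvatureForm] at hcurvature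
  simp only [sectionalCurvature, coordSectionalCurvature, chartMetric_coordVector,
    inner_smul_add_smul he hn hen, hgram, hcurvature]
  exact mul_div_cancel_left₀ _ (pow_ne_zero 2 hdet)

end SectionalCurvature

section Distance

variable {E : Type*} [NormedAddCommGroup E] [NormedSpace ℝ E]
  {H : Type*} [TopologicalSpace H] {I : ModelWithCorners ℝ E H}
  {M : Type*} [EMetricSpace M] [ChartedSpace H M]
  [RiemannianBundle (fun x : M ↦ TangentSpace I x)] [IsRiemannianManifold I M]

theorem edist_le_of_norm_mfderiv_le {γ : ℝ → M} {a b L : ℝ} (hab : a ≤ b)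
    (hγ : ∀ t ∈ Icc a b, ContMDiffAt 𝓘(ℝ, ℝ) I 1 γ t)
    (hL : ∀ t ∈ Icc a b, ‖mfderiv 𝓘(ℝ, ℝ) I γ t (1 : ℝ)‖ ≤ L) :
    edist (γ a) (γ b) ≤ ENNReal.ofReal (L * (b - a)) := by
  have hL0 : 0 ≤ L := (norm_nonneg _).trans (hL a (left_mem_Icc.2 hab))
  calc
    edist (γ a) (γ b) = riemannianEDist I (γ a) (γ b) := IsRiemannianManifold.out _ _
    _ ≤ pathELength I γ a b :=
      riemannianEDist_le_pathELength (fun t ht ↦ (hγ t ht).contMDiffWithinAt) rfl rfl hab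
    _ = ∫⁻ t in Icc a b, ‖mfderiv 𝓘(ℝ, ℝ) I γ t (1 : ℝ)‖ₑ := pathELength_eq_lintegral_mfderiv_Icc
    _ ≤ ∫⁻ _ in Icc a b, ENNReal.ofReal L :=
      MeasureTheory.setLIntegral_mono' measurableSet_Icc fun t ht ↦ by
        rw [← ofReal_norm]
        exact ENNReal.ofReal_le_ofReal (hL t ht)
    _ = ENNReal.ofReal (L * (b - a)) := by
      rw [MeasureTheory.setLIntegral_const, Real.volume_Icc, ENNReal.ofReal_mul hL0]

theorem edist_comp_le_of_norm_mfderiv_le {V : Type*} [NormedAddCommGroup V] [NormedSpace ℝ V]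
    {F : V → M} {c c' : ℝ → V} {a b L : ℝ} (hab : a ≤ b) (hc : ContDiff ℝ 1 c)
    (hc' : ∀ t, HasDerivAt c (c' t) t)
    (hF : ∀ t ∈ Icc a b, ContMDiffAt 𝓘(ℝ, V) I 1 F (c t))
    (hL : ∀ t ∈ Icc a b, ‖mfderiv 𝓘(ℝ, V) I F (c t) (c' t)‖ ≤ L) :
    edist (F (c a)) (F (c b)) ≤ ENNReal.ofReal (L * (b - a)) := by
  refine edist_le_of_norm_mfderiv_le (I := I) (γ := fun t ↦ F (c t)) hab
    (fun t ht ↦ (hF t ht).comp t hc.contMDiff.contMDiffAt) fun t ht ↦ ?_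
  have hchain := mfderiv_comp_apply t ((hF t ht).mdifferentiableAt one_ne_zero)
    (hc' t).differentiableAt.mdifferentiableAt (1 : ℝ)
  have hvelocity : mfderiv 𝓘(ℝ, ℝ) 𝓘(ℝ, V) c t (1 : ℝ) = c' t := by
    rw [mfderiv_eq_fderiv]
    exact (hc' t).deriv
  rw [hvelocity] at hchain
  exact (congrArg norm hchain).trans_le (hL t ht)

variable [IsManifold I ∞ M] {q : M}

theorem edist_exp_arc_le {e n : TangentSpace I q} (he : ‖e‖ = 1) (hn : ‖n‖ = 1)
    (hen : inner ℝ e n = 0) {δ θ L : ℝ} (hδ : 0 ≤ δ) (hθ : 0 ≤ θ)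
    (hr : ENNReal.ofReal δ < injectivityRadius I q)
    (hL : ∀ s, ‖mfderiv 𝓘(ℝ, TangentSpace I q) I (Exp I q)
      (δ • (Real.cos s • e + Real.sin s • n)) (-Real.sin s • e + Real.cos s • n)‖ ≤ L) :
    edist (Exp I q (δ • e)) (Exp I q (δ • (Real.cos θ • e + Real.sin θ • n))) ≤
      ENNReal.ofReal (θ * δ * L) := by
  let c : ℝ → TangentSpace I q := fun s ↦ δ • (Real.cos s • e + Real.sin s • n)
  have hsmooth : ContDiff ℝ 1 c :=
    ((Real.contDiff_cos.smul contDiff_const).add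
      (Real.contDiff_sin.smul contDiff_const)).const_smul δ
  have hderiv (s : ℝ) : HasDerivAt c (δ • (-Real.sin s • e + Real.cos s • n)) s :=
    (((Real.hasDerivAt_cos s).smul_const e).add
      ((Real.hasDerivAt_sin s).smul_const n)).const_smul δ
  have hnorm (s : ℝ) : ‖c s‖ₑ < injectivityRadius I q := by
    rwa [← ofReal_norm, norm_smul, Real.norm_of_nonneg hδ,
      norm_smul_add_smul_eq_one he hn hen (Real.cos_sq_add_sin_sq s), mul_one]
  have hle := edist_comp_le_of_norm_mfderiv_le (I := I) (L := δ * L) hθ hsmooth hderiv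
    (fun s _ ↦ (contMDiffAt_exp (hnorm s)).of_le ENat.LEInfty.out) fun s _ ↦ by
      refine (congrArg norm (map_smul (mfderiv 𝓘(ℝ, TangentSpace I q) I (Exp I q) (c s)) δ
        _)).trans_le ?_
      rw [norm_smul, Real.norm_of_nonneg hδ]
      exact mul_le_mul_of_nonneg_left (hL s) hδ
  simpa [c, mul_comm, mul_assoc, mul_left_comm] using hle

variable [FiniteDimensional ℝ E] [I.Boundaryless]
  [IsContMDiffRiemannianBundle I ∞ E (fun x : M ↦ TangentSpace I x)]

theorem edist_exp_smul_le {v : TangentSpace I q} (hv : ‖v‖ₑ < injectivityRadius I q) {τ : ℝ}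
    (hτ : τ ∈ Icc (0 : ℝ) 1) :
    edist (Exp I q (τ • v)) (Exp I q v) ≤ ENNReal.ofReal (‖v‖ * (1 - τ)) := by
  obtain ⟨c, hc⟩ := exists_isGeodesicFrom hv
  have hend : Exp I q v = c 1 := by simpa using hc.exp_smul (τ := 1) (by simp)
  have hsub {t : ℝ} (ht : t ∈ Icc τ 1) : t ∈ Icc (0 : ℝ) 1 := ⟨hτ.1.trans ht.1, ht.2⟩
  rw [hend, hc.exp_smul hτ]
  exact edist_le_of_norm_mfderiv_le (I := I) hτ.2
    (fun t ht ↦ (hc.1 t (hsub ht)).1.of_le ENat.LEInfty.out)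
    (fun t ht ↦ (hc.norm_mfderiv_eq (hsub ht)).le)

theorem edist_exp_ray_le {e : TangentSpace I q} (he : ‖e‖ = 1) {r s : ℝ} (hr : 0 < r) (hs : 0 < s)
    (hr' : ENNReal.ofReal r < injectivityRadius I q)
    (hs' : ENNReal.ofReal s < injectivityRadius I q) :
    edist (Exp I q (r • e)) (Exp I q (s • e)) ≤ ENNReal.ofReal |r - s| := by
  wlog hrs : r ≤ s generalizing r s
  · rw [edist_comm, abs_sub_comm]
    exact this hs hr hs' hr' (le_of_not_ge hrs)
  have hnorm : ‖s • e‖ = s := by rw [norm_smul, he, mul_one, Real.norm_of_nonneg hs.le]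
  have hle := edist_exp_smul_le (v := s • e) (by rwa [← ofReal_norm, hnorm])
    (τ := r / s) ⟨by positivity, (div_le_one hs).2 hrs⟩
  have hlength : s * (1 - r / s) = |r - s| := by
    rw [abs_of_nonpos (sub_nonpos.2 hrs), mul_sub, mul_one, mul_div_cancel₀ _ hs.ne', neg_sub]
  rwa [smul_smul, div_mul_cancel₀ _ hs.ne', hnorm, hlength] at hle

theorem edist_exp_le {e n : TangentSpace I q} (he : ‖e‖ = 1) (hn : ‖n‖ = 1)
    (hen : inner ℝ e n = 0) {δ δ' θ L : ℝ} (hδ : 0 < δ) (hδ' : 0 < δ') (hθ : 0 ≤ θ)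
    (hr : ENNReal.ofReal δ < injectivityRadius I q)
    (hr' : ENNReal.ofReal δ' < injectivityRadius I q)
    (hL : ∀ s, ‖mfderiv 𝓘(ℝ, TangentSpace I q) I (Exp I q)
      (δ • (Real.cos s • e + Real.sin s • n)) (-Real.sin s • e + Real.cos s • n)‖ ≤ L) :
    edist (Exp I q (δ • e)) (Exp I q (δ' • (Real.cos θ • e + Real.sin θ • n))) ≤
      ENNReal.ofReal (|δ - δ'| + θ * δ * L) := by
  have hL0 : 0 ≤ L := (norm_nonneg _).trans (hL 0)
  have harc := edist_exp_arc_le he hn hen hδ.le hθ hr hL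
  have hray := edist_exp_ray_le
    (norm_smul_add_smul_eq_one he hn hen (Real.cos_sq_add_sin_sq θ)) hδ hδ' hr hr'
  rw [add_comm |δ - δ'|, ENNReal.ofReal_add (by positivity) (abs_nonneg _)]
  exact (edist_triangle _ _ _).trans (add_le_add harc hray)

end Distance

end RiemannianGeometry

end

theorem theorem3p1_general
    {E : Type*} [NormedAddCommGroup E] [NormedSpace ℝ E] [FiniteDimensional ℝ E]
    {H : Type*} [TopologicalSpace H] (I : ModelWithCorners ℝ E H) [I.Boundaryless]
    {M : Type*} [EMetricSpace M] [ChartedSpace H M] [IsManifold I ∞ M]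
    [RiemannianBundle (fun x : M ↦ TangentSpace I x)]
    [IsContMDiffRiemannianBundle I ∞ E (fun x : M ↦ TangentSpace I x)]
    [IsRiemannianManifold I M] (q : M) :
    ∃ η : ℝ → ℝ, η =o[𝓝[>] 0] (fun δ : ℝ ↦ δ ^ 2) ∧
      ∀ Δ Δ' : TangentSpace I q,
        LinearIndependent ℝ ![Δ, Δ'] →
        ‖Δ‖ₑ < RiemannianGeometry.injectivityRadius I q →
        ‖Δ'‖ₑ < RiemannianGeometry.injectivityRadius I q →
        edist (RiemannianGeometry.Exp I q Δ) (RiemannianGeometry.Exp I q Δ') ≠ ⊤ ∧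
        (edist (RiemannianGeometry.Exp I q Δ) (RiemannianGeometry.Exp I q Δ')).toReal ≤
          |‖Δ‖ - ‖Δ'‖|
            + InnerProductGeometry.angle Δ Δ' * ‖Δ‖ *
                (1 - RiemannianGeometry.sectionalCurvature I q Δ Δ' / 6 * ‖Δ‖ ^ 2 + η ‖Δ‖) := by
  open RiemannianGeometry InnerProductGeometry in
  obtain ⟨η, hη, hstretch⟩ := exists_norm_mfderiv_exp_le (I := I) q
  refine ⟨η, hη, fun Δ Δ' hli hr hr' ↦ ?_⟩
  have hδ : 0 < ‖Δ‖ := norm_pos_iff.2 (hli.ne_zero 0)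
  have hδ' : 0 < ‖Δ'‖ := norm_pos_iff.2 (hli.ne_zero 1)
  have hsin := sin_angle_pos_of_linearIndependent hli
  obtain ⟨e, n, he, hn, hen, hΔ, hΔ'⟩ := exists_orthonormal_of_linearIndependent hli
  rw [← ofReal_norm] at hr hr'
  have hK : sectionalCurvature I q Δ Δ' = curvatureForm I q e n := by
    have heq := sectionalCurvature_eq he hn hen (a := ‖Δ‖) (b := 0)
      (c := ‖Δ'‖ * Real.cos (angle Δ Δ')) (d := ‖Δ'‖ * Real.sin (angle Δ Δ'))
      (by rw [zero_mul, sub_zero]; positivity)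
    rwa [zero_smul, add_zero, ← hΔ, mul_smul, mul_smul, ← smul_add, ← hΔ'] at heq
  have harc (s : ℝ) : ‖mfderiv 𝓘(ℝ, TangentSpace I q) I (Exp I q)
      (‖Δ‖ • (Real.cos s • e + Real.sin s • n)) (-Real.sin s • e + Real.cos s • n)‖
        ≤ 1 - sectionalCurvature I q Δ Δ' / 6 * ‖Δ‖ ^ 2 + η ‖Δ‖ := by
    rw [hK, ← curvatureForm_rotate e n s]
    exact hstretch _ hδ.le hr _ _
      (norm_smul_add_smul_eq_one he hn hen (Real.cos_sq_add_sin_sq s))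
      (norm_smul_add_smul_eq_one he hn hen (by rw [neg_sq, Real.sin_sq_add_cos_sq]))
  have hle := edist_exp_le he hn hen hδ hδ' (angle_nonneg Δ Δ') hr hr' harc
  have hnonneg := (norm_nonneg _).trans (harc 0)
  have := angle_nonneg Δ Δ'
  rw [← hΔ, ← hΔ'] at hle
  exact ⟨ne_top_of_le_ne_top ENNReal.ofReal_ne_top hle,
    ENNReal.toReal_le_of_le_ofReal (by positivity) hle⟩

theorem theorem3p1
    {E : Type*} [NormedAddCommGroup E] [NormedSpace ℝ E] [FiniteDimensional ℝ E]
    {H : Type*} [TopologicalSpace H] (I : ModelWithCorners ℝ E H) [I.Boundaryless]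
    {M : Type*} [EMetricSpace M] [ChartedSpace H M] [IsManifold I ∞ M]
    [RiemannianBundle (fun x : M ↦ TangentSpace I x)]
    [IsContMDiffRiemannianBundle I ∞ E (fun x : M ↦ TangentSpace I x)]
    [IsRiemannianManifold I M] (q : M) :
    ∃ (η : ℝ → ℝ) (C : ℝ), η =o[𝓝[>] 0] (fun δ : ℝ ↦ δ ^ 2) ∧
      ∀ Δ Δ' : TangentSpace I q,
        LinearIndependent ℝ ![Δ, Δ'] →
        ‖Δ‖ < 1 → ‖Δ'‖ < 1 →
        ‖Δ‖ₑ < RiemannianGeometry.injectivityRadius I q →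
        ‖Δ'‖ₑ < RiemannianGeometry.injectivityRadius I q →
        edist (RiemannianGeometry.Exp I q Δ) (RiemannianGeometry.Exp I q Δ') ≠ ⊤ ∧
        (edist (RiemannianGeometry.Exp I q Δ) (RiemannianGeometry.Exp I q Δ')).toReal ≤
          |‖Δ‖ - ‖Δ'‖|
            + InnerProductGeometry.angle Δ Δ' * ‖Δ‖ *
                (1 - RiemannianGeometry.sectionalCurvature I q Δ Δ' / 6 * ‖Δ‖ ^ 2 + η ‖Δ‖)
            + C * InnerProductGeometry.angle Δ Δ' ^ 2 := by
  obtain ⟨η, hη, hle⟩ := theorem3p1_general I q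
  exact ⟨η, 0, hη, fun Δ Δ' hli _ _ hr hr' ↦ by simpa using hle Δ Δ' hli hr hr'⟩
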